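/- Let $d\in\mathbb N$, let $(\Omega,\mathcal A,\mathbb P)$ be a probability space, and let $G=(G(t))_{t\in\mathbb R^d}$ be a complex Gaussian random field on it, i.e. the $G(t):\Omega\to\mathbb C$ are square-integrable and the real and imaginary parts of any finitely many $G(t_1),\dots,G(t_n)$ are jointly (real) Gaussian; the real and imaginary parts may be dependent. Assume that $G$ is measurable (i.e. $(t,\omega)\mapsto G(t)(\omega)$ is jointly measurable), centered ($\mathbb E[G(t)]=0$ for all $t$) and hermitian, in the sense that the covariance kernel $K(s,t)=\mathbb E[G(s)\overline{G(t)}]$ and the pseudo-covariance kernel $C(s,t)=\mathbb E[G(s)G(t)]$ satisfy $K(s,t)=C(s,-t)$ for all $s,t$ (which holds if $G(-t)=\overline{G(t)}$ a.s. for every $t$). Let $\rho$ be a $\sigma$-finite Borel measure on $\mathbb R^d$ that is symmetric (invariant under $t\mapsto -t$) and satisfies $$\int_{\mathbb R^d} K(t,t)\,\rho(dt)<\infty,$$ and let $T_K:L^2(\rho)\to L^2(\rho)$, $(T_Ku)(s)=\int_{\mathbb R^d} K(s,t)u(t)\,\rho(dt)$, be the associated covariance operator on complex-valued functions. (i) There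 exist an index set $I\subseteq\mathbb N$, a decreasing family $(\alpha_i)_{i\in I}$ of positive, not necessarily distinct, real numbers and an orthonormal system $(e_i)_{i\in I}$ in $L^2(\rho)$ such that $$T_Ke_i=\alpha_ie_i\quad(i\in I),\qquad \overline{\operatorname{range}T_K}=\overline{\operatorname{span}}\{e_i: i\in I\}.\tag{1}$$ (ii) For every choice of $I$, $(\alpha_i)_{i\in I}$, $(e_i)_{i\in I}$ as in (i), Mercer's representation $$K(s,t)=\sum_{i\in I}\alpha_i e_i(s)\overline{e_i(t)}$$ holds for $\rho\otimes\rho$-almost all $(s,t)$, and there is a family $(Z_i)_{i\in I}$ of independent, standard normally distributed real random variables on $(\Omega,\mathcal A,\mathbb P)$ such that $\mathbb P$-almost surely $G\in L^2(\rho)$ and $$\|G\|_\rho^2:=\int_{\mathbb R^d}|G(t)|^2\,\rho(dt)=\sum_{i\in I}\alpha_iZ_i^2 .$$ -/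

import Mathlib

open MeasureTheory ProbabilityTheory
open scoped ComplexConjugate

/-- The covariance kernel `K(s,t) = E[(G(s) - m(s)) conj (G(t) - m(t))]`, `m(t) = E[G(t)]`. -/
noncomputable def covKernel {T Ω : Type*} [MeasurableSpace Ω] (P : Measure Ω)
    (G : T → Ω → ℂ) (s t : T) : ℂ :=
  ∫ ω, (G s ω - ∫ ω', G s ω' ∂P) * conj (G t ω - ∫ ω', G t ω' ∂P) ∂P

/-- The pseudo-covariance kernel `C(s,t) = E[(G(s) - m(s)) (G(t) - m(t))]`. -/
noncomputable def pseudoCovKernel {T Ω : Type*} [MeasurableSpace Ω] (P : Measure Ω)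
    (G : T → Ω → ℂ) (s t : T) : ℂ :=
  ∫ ω, (G s ω - ∫ ω', G s ω' ∂P) * (G t ω - ∫ ω', G t ω' ∂P) ∂P

/-- A hermitian, centered, (jointly) measurable complex Gaussian random field on `ℝ^d`.
Hermiticity is the requirement `K(s,t) = C(s,-t)`, which follows from `G(-t) = conj (G(t))`.
Gaussianity is joint real Gaussianity of the real and imaginary parts of finitely many values
(`IsGaussianProcess` over the real vector space `ℂ`): the pseudo-covariance need not vanish. -/
structure IsHermitianGaussianField {d : ℕ} {Ω : Type*} [MeasurableSpace Ω] (P : Measure Ω)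
    (G : EuclideanSpace ℝ (Fin d) → Ω → ℂ) : Prop where
  measurable : Measurable (fun p : EuclideanSpace ℝ (Fin d) × Ω => G p.1 p.2)
  memLp_two : ∀ t, MemLp (G t) 2 P
  centered : ∀ t, ∫ ω, G t ω ∂P = 0
  hermitian : ∀ s t, covKernel P G s t = pseudoCovKernel P G s (-t)
  gaussian : IsGaussianProcess G P

section IntegralOperator

variable {T : Type*} [MeasurableSpace T]

/-- `(T_K u)(s) = ∫ K(s,t) u(t) ρ(dt)`, as a function. -/
noncomputable def kernelIntegral (ρ : Measure T) (K : T → T → ℂ) (u : T → ℂ) (s : T) : ℂ :=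
  ∫ t, K s t * u t ∂ρ

/-- A kernel in `L²(ρ ⊗ ρ)` maps `L²(ρ)` to `L²(ρ)`. -/
theorem memLp_kernelIntegral (ρ : Measure T) [SigmaFinite ρ] (K : T → T → ℂ)
    (hK : MemLp (fun p : T × T => K p.1 p.2) 2 (ρ.prod ρ)) (u : Lp ℂ 2 ρ) :
    MemLp (kernelIntegral ρ K u) 2 ρ := by
  have hu : MemLp u 2 ρ := Lp.memLp u
  have hm : AEStronglyMeasurable (fun p : T × T => K p.1 p.2 * u p.2) (ρ.prod ρ) :=
    hK.1.mul (hu.1.comp_quasiMeasurePreserving Measure.quasiMeasurePreserving_snd)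
  refine ⟨hm.integral_prod_right', ?_⟩
  rw [eLpNorm_lt_top_iff_lintegral_rpow_enorm_lt_top (by norm_num) (by norm_num)]
  have hK2 := (eLpNorm_lt_top_iff_lintegral_rpow_enorm_lt_top (by norm_num) (by norm_num)).1 hK.2
  have hu2 := (eLpNorm_lt_top_iff_lintegral_rpow_enorm_lt_top (by norm_num) (by norm_num)).1 hu.2
  have hKm : AEMeasurable (fun p : T × T => ‖K p.1 p.2‖ₑ ^ (2 : ENNReal).toReal) (ρ.prod ρ) :=
    hK.1.enorm.pow_const _
  rw [lintegral_prod _ hKm] at hK2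
  have hsec := hK.1.prodMk_left
  calc ∫⁻ s, ‖kernelIntegral ρ K u s‖ₑ ^ (2 : ENNReal).toReal ∂ρ
      ≤ ∫⁻ s, (∫⁻ t, ‖K s t‖ₑ ^ (2 : ENNReal).toReal ∂ρ) *
          (∫⁻ t, ‖u t‖ₑ ^ (2 : ENNReal).toReal ∂ρ) ∂ρ := by
        refine lintegral_mono_ae ?_
        filter_upwards [hsec] with s hs
        have h1 : ‖kernelIntegral ρ K u s‖ₑ ≤ ∫⁻ t, ‖K s t‖ₑ * ‖u t‖ₑ ∂ρ := by
          refine (enorm_integral_le_lintegral_enorm _).trans_eq ?_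
          simp only [enorm_mul]
        have h2 := ENNReal.lintegral_mul_le_Lp_mul_Lq ρ Real.HolderConjugate.two_two
          hs.enorm hu.1.enorm
        have h3 := ENNReal.rpow_le_rpow (h1.trans h2) (zero_le_two (α := ℝ))
        rw [ENNReal.mul_rpow_of_nonneg _ _ zero_le_two, ← ENNReal.rpow_mul,
          ← ENNReal.rpow_mul] at h3
        simpa using h3
    _ < ⊤ := by
        rw [lintegral_mul_const'' _ hKm.lintegral_prod_right']
        exact ENNReal.mul_lt_top hK2 hu2

open Classical in
/-- The integral operator `T_K : L²(ρ) → L²(ρ)` with kernel `K`. The second branch is never taken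
when `K` is square integrable with respect to `ρ ⊗ ρ`. -/
noncomputable def kernelOperator (ρ : Measure T) (K : T → T → ℂ) (u : Lp ℂ 2 ρ) : Lp ℂ 2 ρ :=
  if h : MemLp (kernelIntegral ρ K u) 2 ρ then h.toLp _ else 0

/-- The family `(α_i, e_i)`, `i ∈ I ⊆ ℕ`, lists the positive eigenvalues of `T_K`, repeated according
to multiplicity and in decreasing order, with an orthonormal system of eigenvectors whose closed
linear span is the closure of the range of `T_K`. -/
structure IsMercerSystem (ρ : Measure T) (K : T → T → ℂ) (I : Set ℕ) (α : I → ℝ)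
    (e : I → Lp ℂ 2 ρ) : Prop where
  pos : ∀ i, 0 < α i
  antitone : Antitone α
  orthonormal : Orthonormal ℂ e
  eigen : ∀ i, kernelOperator ρ K (e i) = (α i : ℂ) • e i
  closure_range : closure (Set.range (kernelOperator ρ K)) =
    closure (Submodule.span ℂ (Set.range e) : Set (Lp ℂ 2 ρ))

end IntegralOperator

/-! Since `E|G(t)|² = K(t,t)` is integrable, the path of `G` is a random element `g` of `L²(ρ)` with
`E‖g‖² < ∞`, and by Fubini `T_K` is its covariance operator, with `⟪u, T_K v⟫ = E[⟪u, g⟫ ⟪g, v⟫]`.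
It is symmetric, positive and compact, and its trace is bounded by `E‖g‖²`. The spectral theorem
gives (i); moreover `g` lies a.s. in the closed span of the eigenvectors, because `E|⟪v, g⟫|² = ⟪v,
T_K v⟫` vanishes for `v` orthogonal to the range.

Parseval would write `‖g‖²` as a sum of `|⟪e_i, g⟫|²`, but these coordinates may be complex with
dependent real and imaginary parts. Hermiticity repairs this: it forces `G(-t) = conj (G(t))` a.s.,
so `g` is fixed by the antiunitary involution `J u(t) = conj (u(-t))`, which commutes with `T_K`.
Every eigenspace with positive eigenvalue then has an orthonormal basis of `J`-fixed vectors `b`,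
for which `⟪b, g⟫` is real. These coordinates are jointly Gaussian, being `L²(P)`-limits of
combinations of `Re G(t)` and `Im G(t)`, and uncorrelated, hence independent. Any other system has
the same eigenvalues with the same multiplicities, so its index set can be matched with that of `b`
(`exists_equiv_eigenbasis`).

Mercer's formula is Parseval in `L²(P)`. The normalized coordinates `⟪e_i, g⟫ / √α_i` are
orthonormal, and `G(s)` has coefficients `√α_i e_i(s)`. Bessel's inequality for `G(s)` is an
equality for almost every `s`, since both sides have the same finite integral. -/

/-! ### Orthonormal expansions, enumeration by weight, bases fixed by a conjugation. -/

section HilbertSpace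

open scoped InnerProductSpace

variable {ι H : Type*} [NormedAddCommGroup H] [InnerProductSpace ℂ H]

/-- Inside its closed span the family is a Hilbert basis, so `x` is the sum of its Fourier series.
-/
theorem Orthonormal.hasSum_inner_mul_inner_of_mem_closure [CompleteSpace H] {e : ι → H}
    (he : Orthonormal ℂ e) {x : H}
    (hx : x ∈ (Submodule.span ℂ (Set.range e)).topologicalClosure) (y : H) :
    HasSum (fun i => ⟪y, e i⟫_ℂ * ⟪e i, x⟫_ℂ) ⟪y, x⟫_ℂ := by
  set K := (Submodule.span ℂ (Set.range e)).topologicalClosure with hK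
  have heK : ∀ i, e i ∈ K := fun i =>
    Submodule.le_topologicalClosure _ (Submodule.subset_span ⟨i, rfl⟩)
  have : CompleteSpace K :=
    (Submodule.isClosed_topologicalClosure (Submodule.span ℂ (Set.range e))).completeSpace_coe
  let w : ι → K := fun i => ⟨e i, heK i⟩
  have hw : Orthonormal ℂ w := by
    classical
    rw [orthonormal_iff_ite] at he ⊢
    exact he
  have hbot : (Submodule.span ℂ (Set.range w))ᗮ = ⊥ := by
    rw [Submodule.eq_bot_iff]
    intro k hk
    have h1 : (k : H) ∈ (Submodule.span ℂ (Set.range e))ᗮ := by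
      rw [Submodule.mem_orthogonal]
      intro u hu
      induction hu using Submodule.span_induction with
      | mem x hx =>
        obtain ⟨i, rfl⟩ := hx
        exact (Submodule.mem_orthogonal _ _).1 hk (w i) (Submodule.subset_span ⟨i, rfl⟩)
      | zero => simp
      | add x y _ _ hx hy => rw [inner_add_left, hx, hy, add_zero]
      | smul a x _ hx => rw [inner_smul_left, hx, mul_zero]
    rw [← Submodule.orthogonal_closure, ← hK] at h1
    have h2 : ⟪(k : H), k⟫_ℂ = 0 := (Submodule.mem_orthogonal _ _).1 h1 k k.2
    exact Subtype.ext (inner_self_eq_zero.1 h2)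
  let b := HilbertBasis.mkOfOrthogonalEqBot hw hbot
  have hsum := (b.hasSum_repr ⟨x, hx⟩).mapL (innerSL ℂ y ∘L K.subtypeL)
  simp only [b, HilbertBasis.repr_apply_apply, HilbertBasis.coe_mkOfOrthogonalEqBot,
    map_smul] at hsum
  simpa [w, mul_comm] using hsum

theorem Orthonormal.hasSum_norm_sq_of_mem_closure [CompleteSpace H] {e : ι → H}
    (he : Orthonormal ℂ e) {x : H}
    (hx : x ∈ (Submodule.span ℂ (Set.range e)).topologicalClosure) :
    HasSum (fun i => ‖⟪e i, x⟫_ℂ‖ ^ 2) (‖x‖ ^ 2) := by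
  have h := Complex.hasSum_re (he.hasSum_inner_mul_inner_of_mem_closure hx x)
  convert h using 1
  · funext i
    rw [← inner_conj_symm x, mul_comm, Complex.mul_conj, Complex.ofReal_re,
      Complex.normSq_eq_norm_sq]
  · exact (inner_self_eq_norm_sq (𝕜 := ℂ) x).symm

theorem Orthonormal.norm_sub_sum_sq {e : ι → H} (he : Orthonormal ℂ e) (x : H) (F : Finset ι) :
    ‖x - ∑ i ∈ F, ⟪e i, x⟫_ℂ • e i‖ ^ 2 = ‖x‖ ^ 2 - ∑ i ∈ F, ‖⟪e i, x⟫_ℂ‖ ^ 2 := by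
  have h1 : ⟪x, ∑ i ∈ F, ⟪e i, x⟫_ℂ • e i⟫_ℂ = ((∑ i ∈ F, ‖⟪e i, x⟫_ℂ‖ ^ 2 : ℝ) : ℂ) := by
    rw [inner_sum]
    push_cast
    refine Finset.sum_congr rfl fun i _ => ?_
    rw [inner_smul_right, ← inner_conj_symm x, Complex.mul_conj, Complex.normSq_eq_norm_sq]
    push_cast
    rfl
  have h2 : ‖∑ i ∈ F, ⟪e i, x⟫_ℂ • e i‖ ^ 2 = ∑ i ∈ F, ‖⟪e i, x⟫_ℂ‖ ^ 2 := by
    have h := he.inner_sum (fun i => ⟪e i, x⟫_ℂ) (fun i => ⟪e i, x⟫_ℂ) F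
    have h' := congrArg Complex.re h
    rw [Complex.re_sum] at h'
    rw [← inner_self_eq_norm_sq (𝕜 := ℂ)]
    refine h'.trans (Finset.sum_congr rfl fun i _ => ?_)
    rw [mul_comm, Complex.mul_conj, Complex.ofReal_re, Complex.normSq_eq_norm_sq]
  rw [norm_sub_sq (𝕜 := ℂ), h1, h2]
  simp only [RCLike.re_eq_complex_re, Complex.ofReal_re]
  ring

/-- Equality in Bessel's inequality makes the remainders of the Fourier series of `x` tend to zero.
This serves where Parseval is known for `x` but membership in the closed span is not. -/
theorem Orthonormal.hasSum_inner_mul_inner_of_hasSum_norm_sq {e : ι → H}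
    (he : Orthonormal ℂ e) {x : H} (hx : HasSum (fun i => ‖⟪e i, x⟫_ℂ‖ ^ 2) (‖x‖ ^ 2)) (y : H) :
    HasSum (fun i => ⟪y, e i⟫_ℂ * ⟪e i, x⟫_ℂ) ⟪y, x⟫_ℂ := by
  have h : HasSum (fun i => ⟪e i, x⟫_ℂ • e i) x := by
    rw [HasSum, SummationFilter.unconditional_filter, tendsto_iff_norm_sub_tendsto_zero]
    have h1 := (tendsto_const_nhds (x := ‖x‖ ^ 2)).sub hx
    rw [SummationFilter.unconditional_filter, sub_self] at h1
    have h2 := (Real.continuous_sqrt.tendsto 0).comp h1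
    rw [Real.sqrt_zero] at h2
    refine h2.congr fun F => ?_
    rw [Function.comp_apply, ← he.norm_sub_sum_sq, Real.sqrt_sq (norm_nonneg _), norm_sub_rev]
  simpa [mul_comm] using h.mapL (innerSL ℂ y)

/-- Each element is numbered by how many others precede it when sorted by decreasing weight, ties
being broken by an injection into `ℕ`. The number is finite because predecessors have at least the
same weight. -/
theorem exists_antitone_enumeration {S : Type*} (w : S → ℝ) (hw : ∀ s, 0 < w s)
    (hfin : ∀ c > 0, {s | c ≤ w s}.Finite) :
    ∃ (I : Set ℕ) (φ : I ≃ S), Antitone (w ∘ φ) := by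
  have hcount : Countable S := by
    rw [← Set.countable_univ_iff]
    have : (Set.univ : Set S) = ⋃ n : ℕ, {s | 1 / ((n : ℝ) + 1) ≤ w s} := by
      refine (Set.eq_univ_of_forall fun s => ?_).symm
      obtain ⟨n, hn⟩ := exists_nat_one_div_lt (hw s)
      exact Set.mem_iUnion.2 ⟨n, hn.le⟩
    rw [this]
    exact Set.countable_iUnion fun n => (hfin _ (by positivity)).countable
  obtain ⟨enc, henc⟩ := exists_injective_nat S
  let k : S → ℝᵒᵈ ×ₗ ℕ := fun s => toLex (OrderDual.toDual (w s), enc s)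
  have hk : Function.Injective k := by
    intro s t hst
    have h := congrArg (fun p => (ofLex p).2) hst
    exact henc h
  have hle : ∀ {s t}, k s ≤ k t → w t ≤ w s := by
    intro s t h
    rcases (Prod.Lex.le_iff).1 h with h | h
    · exact (OrderDual.toDual_lt_toDual.1 h).le
    · exact (OrderDual.toDual_inj.1 h.1).ge
  have hpred : ∀ s, {t | k t < k s}.Finite := fun s =>
    (hfin (w s) (hw s)).subset fun t ht => hle (le_of_lt ht)
  let r : S → ℕ := fun s => {t | k t < k s}.ncard
  have hr : ∀ {s t}, k s < k t → r s < r t := by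
    intro s t h
    refine Set.ncard_lt_ncard ⟨fun x hx => lt_trans hx h, fun hsub => ?_⟩ (hpred t)
    exact lt_irrefl (k s) (hsub h)
  have hinj : Function.Injective r := by
    intro s t hst
    by_contra hne
    rcases lt_or_gt_of_ne (fun h => hne (hk h)) with h | h
    · exact (hr h).ne hst
    · exact (hr h).ne' hst
  refine ⟨Set.range r, (Equiv.ofInjective r hinj).symm, fun a b hab => hle ?_⟩
  by_contra hlt
  have h := hr (not_le.1 hlt)
  have hs : ∀ c, r ((Equiv.ofInjective r hinj).symm c) = c := fun c =>
    Equiv.apply_ofInjective_symm hinj c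
  rw [hs, hs] at h
  exact absurd hab (not_le.2 h)

/-- The subspace `E` is the complexification of the real space `R` of its `J`-fixed vectors. Inner
products on `R` are real, so a real orthonormal basis of `R` is orthonormal over `ℂ`. -/
theorem exists_orthonormal_fixed_basis (J : H →ₗ⋆[ℂ] H) (hJJ : ∀ u, J (J u) = u)
    (hJ : ∀ u v, ⟪J u, J v⟫_ℂ = conj ⟪u, v⟫_ℂ) (E : Submodule ℂ H) [FiniteDimensional ℂ E]
    (hE : ∀ u ∈ E, J u ∈ E) :
    ∃ (n : ℕ) (b : Fin n → H), Orthonormal ℂ b ∧ (∀ k, J (b k) = b k) ∧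
      Submodule.span ℂ (Set.range b) = E := by
  let R : Submodule ℝ H :=
    { carrier := {u | u ∈ E ∧ J u = u}
      add_mem' := fun {a b} ha hb => ⟨E.add_mem ha.1 hb.1, by rw [map_add, ha.2, hb.2]⟩
      zero_mem' := ⟨E.zero_mem, map_zero J⟩
      smul_mem' := fun c x hx => by
        refine ⟨?_, ?_⟩
        · exact (E.restrictScalars ℝ).smul_mem c hx.1
        · rw [← Complex.coe_smul, map_smulₛₗ, hx.2, Complex.conj_ofReal] }
  have hR : R ≤ E.restrictScalars ℝ := fun u hu => hu.1
  have : FiniteDimensional ℝ (E.restrictScalars ℝ) := FiniteDimensional.complexToReal E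
  let : InnerProductSpace ℝ H := InnerProductSpace.complexToReal
  have : FiniteDimensional ℝ R := Submodule.finiteDimensional_of_le hR
  let b := stdOrthonormalBasis ℝ R
  have hb : ∀ k, ((b k : R) : H) ∈ E ∧ J (b k) = b k := fun k => (b k).2
  refine ⟨_, fun k => ((b k : R) : H), ?_, fun k => (hb k).2, ?_⟩
  · rw [orthonormal_iff_ite]
    intro i j
    have h1 : conj ⟪((b i : R) : H), b j⟫_ℂ = ⟪((b i : R) : H), b j⟫_ℂ := by
      rw [← hJ, (hb i).2, (hb j).2]
    have h2 : (⟪((b i : R) : H), b j⟫_ℂ).re = if i = j then 1 else 0 :=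
      orthonormal_iff_ite.1 b.orthonormal i j
    rw [← Complex.conj_eq_iff_re.1 h1, h2]
    split_ifs <;> simp
  · refine le_antisymm (Submodule.span_le.2 ?_) fun u hu => ?_
    · rintro _ ⟨k, rfl⟩
      exact (hb k).1
    · have hmem : ∀ x ∈ R, x ∈ Submodule.span ℂ (Set.range fun k => ((b k : R) : H)) := by
        intro x hx
        have h := b.sum_repr ⟨x, hx⟩
        have h' : x = ∑ i, (b.repr ⟨x, hx⟩ i) • ((b i : R) : H) := by
          conv_lhs => rw [← Subtype.coe_mk (p := (· ∈ R)) x hx, ← h]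
          simp
        rw [h']
        refine Submodule.sum_mem _ fun i _ => ?_
        rw [← Complex.coe_smul]
        exact Submodule.smul_mem _ _ (Submodule.subset_span ⟨i, rfl⟩)
      have h1 : u + J u ∈ R := ⟨E.add_mem hu (hE u hu), by rw [map_add, hJJ, add_comm]⟩
      -- `J` changes the sign of `u - J u` and, being conjugate-linear, also that of `I`.
      have h2 : Complex.I • (u - J u) ∈ R :=
        ⟨E.smul_mem _ (E.sub_mem hu (hE u hu)), by
          rw [map_smulₛₗ, map_sub, hJJ, Complex.conj_I, neg_smul, ← smul_neg, neg_sub]⟩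
      have h3 : u = (1 / 2 : ℂ) • (u + J u) + (-Complex.I / 2) • (Complex.I • (u - J u)) := by
        rw [smul_smul, show -Complex.I / 2 * Complex.I = 1 / 2 by
          rw [div_mul_eq_mul_div, neg_mul, Complex.I_mul_I, neg_neg]]
        module
      rw [h3]
      exact Submodule.add_mem _ (Submodule.smul_mem _ _ (hmem _ h1))
        (Submodule.smul_mem _ _ (hmem _ h2))

theorem LinearIndependent.nonempty_equiv_of_span_eq {ι' : Type*} {v : ι → H} {w : ι' → H}
    (hv : LinearIndependent ℂ v) (hw : LinearIndependent ℂ w)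
    (h : Submodule.span ℂ (Set.range v) = Submodule.span ℂ (Set.range w)) : Nonempty (ι ≃ ι') :=
  ⟨((Module.Basis.span hv).map (LinearEquiv.ofEq _ _ h)).indexEquiv (Module.Basis.span hw)⟩

end HilbertSpace

/-! ### Spectral theory of positive compact operators. -/

section CompactOperator

open scoped InnerProductSpace
open Module.End

variable {ι H : Type*} [NormedAddCommGroup H] [InnerProductSpace ℂ H]

/-- If `n` of the eigenvalues are at least `c`, the trace bound gives `n * c ≤ C`. -/
theorem finite_setOf_le_eigenvalue {T : H → H} {C : ℝ}
    (htr : ∀ (n : ℕ) (v : Fin n → H), Orthonormal ℂ v → ∑ k, (⟪v k, T (v k)⟫_ℂ).re ≤ C)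
    {α : ι → ℝ} {e : ι → H} (he : Orthonormal ℂ e) (heig : ∀ i, T (e i) = (α i : ℂ) • e i)
    {c : ℝ} (hc : 0 < c) : {i | c ≤ α i}.Finite := by
  by_contra hinf
  obtain ⟨n, hn⟩ := exists_nat_gt (C / c)
  obtain ⟨F, hF, hcard⟩ := Set.Infinite.exists_subset_card_eq hinf n
  let φ : Fin n ≃ F := (F.equivFinOfCardEq hcard).symm
  have h := htr n (fun k => e (φ k))
    (he.comp _ (Subtype.val_injective.comp φ.injective))
  have h1 : ∀ k, (⟪e (φ k), T (e (φ k))⟫_ℂ).re = α (φ k) := fun k => by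
    rw [heig, inner_smul_right, inner_self_eq_norm_sq_to_K, he.1]
    simp
  simp only [h1] at h
  have h2 : ∑ _k : Fin n, c ≤ ∑ k, α (φ k) := Finset.sum_le_sum fun k _ => hF (φ k).2
  rw [Finset.sum_const, Finset.card_univ, Fintype.card_fin, nsmul_eq_mul] at h2
  rw [div_lt_iff₀ hc] at hn
  linarith

theorem closure_range_eq_closure_span {T : H →L[ℂ] H} {α : ι → ℝ} {e : ι → H} (hα : ∀ i, α i ≠ 0)
    (heig : ∀ i, T (e i) = (α i : ℂ) • e i)
    (hrange : Set.range T ⊆ closure (Submodule.span ℂ (Set.range e) : Set H)) :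
    closure (Set.range T) = closure (Submodule.span ℂ (Set.range e) : Set H) := by
  refine Set.Subset.antisymm (closure_minimal hrange isClosed_closure) (closure_mono ?_)
  have : Submodule.span ℂ (Set.range e) ≤ LinearMap.range (T : H →ₗ[ℂ] H) := by
    rw [Submodule.span_le]
    rintro _ ⟨i, rfl⟩
    refine ⟨(α i : ℂ)⁻¹ • e i, ?_⟩
    rw [ContinuousLinearMap.coe_coe, map_smul, heig, smul_smul,
      inv_mul_cancel₀ (Complex.ofReal_ne_zero.2 (hα i)), one_smul]
  exact this

variable [CompleteSpace H] {T : H →L[ℂ] H}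

/-- Let `q` be the part of an eigenvector orthogonal to the `e i` with eigenvalue `l`. It is
orthogonal to the other `e i` by symmetry, yet as `q = T (l⁻¹ • q)` it lies in their closed span, so
it vanishes. -/
theorem LinearMap.IsSymmetric.span_eq_eigenspace (hT : (T : H →ₗ[ℂ] H).IsSymmetric)
    (hcomp : IsCompactOperator T) {α : ι → ℝ} {e : ι → H}
    (heig : ∀ i, T (e i) = (α i : ℂ) • e i)
    (hrange : Set.range T ⊆ closure (Submodule.span ℂ (Set.range e) : Set H))
    {l : ℝ} (hl : l ≠ 0) :
    Submodule.span ℂ (Set.range fun i : {i // α i = l} => e i) =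
      eigenspace (T : H →ₗ[ℂ] H) (l : ℂ) := by
  have hl' : (l : ℂ) ≠ 0 := Complex.ofReal_ne_zero.2 hl
  have hfd : FiniteDimensional ℂ (eigenspace (T : H →ₗ[ℂ] H) (l : ℂ)) :=
    ContinuousLinearMap.finite_dimensional_eigenspace hcomp _ hl'
  set K := Submodule.span ℂ (Set.range fun i : {i // α i = l} => e i) with hK
  have hle : K ≤ eigenspace (T : H →ₗ[ℂ] H) (l : ℂ) := by
    rw [hK, Submodule.span_le]
    rintro _ ⟨i, rfl⟩
    have := heig i
    rw [i.2] at this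
    exact mem_eigenspace_iff.2 this
  have : FiniteDimensional ℂ K := Submodule.finiteDimensional_of_le hle
  refine le_antisymm hle fun u hu => ?_
  obtain ⟨p, hp, q, hq, hpq⟩ := Submodule.exists_add_mem_mem_orthogonal (K := K) u
  have hqE : q ∈ eigenspace (T : H →ₗ[ℂ] H) (l : ℂ) := by
    have : q = u - p := by rw [hpq, add_sub_cancel_left]
    rw [this]
    exact Submodule.sub_mem _ hu (hle hp)
  have hTq : T q = (l : ℂ) • q := mem_eigenspace_iff.1 hqE
  have hqe : ∀ i, ⟪e i, q⟫_ℂ = 0 := by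
    intro i
    by_cases hi : α i = l
    · exact (Submodule.mem_orthogonal _ _).1 hq _ (Submodule.subset_span ⟨⟨i, hi⟩, rfl⟩)
    · have h := hT (e i) q
      simp only [ContinuousLinearMap.coe_coe] at h
      rw [heig, hTq, inner_smul_left, inner_smul_right, Complex.conj_ofReal] at h
      have h' : ((α i : ℂ) - l) * ⟪e i, q⟫_ℂ = 0 := by rw [sub_mul, h, sub_self]
      refine (mul_eq_zero.1 h').resolve_left (sub_ne_zero.2 fun h => hi ?_)
      exact_mod_cast h
  have hqo : q ∈ (Submodule.span ℂ (Set.range e))ᗮ := by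
    rw [Submodule.mem_orthogonal]
    intro x hx
    induction hx using Submodule.span_induction with
    | mem x hx =>
      obtain ⟨i, rfl⟩ := hx
      exact hqe i
    | zero => simp
    | add x y _ _ hx hy => rw [inner_add_left, hx, hy, add_zero]
    | smul a x _ hx => rw [inner_smul_left, hx, mul_zero]
  have hqc : q ∈ (Submodule.span ℂ (Set.range e)).topologicalClosure := by
    refine hrange ⟨(l : ℂ)⁻¹ • q, ?_⟩
    rw [map_smul, hTq, smul_smul, inv_mul_cancel₀ hl', one_smul]
  rw [← Submodule.orthogonal_closure] at hqo
  have hq0 : q = 0 := inner_self_eq_zero.1 ((Submodule.mem_orthogonal _ _).1 hqo q hqc)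
  rw [hpq, hq0, add_zero]
  exact hp

/-- A vector orthogonal to all positive eigenspaces lies in the kernel: its part orthogonal to the
kernel is orthogonal to every eigenspace, hence zero. By symmetry the range is orthogonal to all
such vectors. -/
theorem LinearMap.IsSymmetric.range_subset_closure_span (hT : (T : H →ₗ[ℂ] H).IsSymmetric)
    (hcomp : IsCompactOperator T) (hpos : ∀ v, 0 ≤ (⟪v, T v⟫_ℂ).re) (e : ι → H)
    (hspan : ∀ l : ℝ, 0 < l → eigenspace (T : H →ₗ[ℂ] H) (l : ℂ) ≤
      Submodule.span ℂ (Set.range e)) :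
    Set.range T ⊆ closure (Submodule.span ℂ (Set.range e) : Set H) := by
  have hker : ∀ x ∈ (Submodule.span ℂ (Set.range e))ᗮ, T x = 0 := by
    intro x hx
    let N := eigenspace (T : H →ₗ[ℂ] H) 0
    have hN : ∀ {p}, p ∈ N ↔ T p = 0 := fun {p} => by
      rw [mem_eigenspace_iff, zero_smul]
      rfl
    have hNc : IsClosed (N : Set H) := by
      have : (N : Set H) = T ⁻¹' {0} := by
        ext p
        exact hN
      rw [this]
      exact isClosed_singleton.preimage T.continuous
    have : CompleteSpace N := hNc.completeSpace_coe
    obtain ⟨p, hp, q, hq, hpq⟩ := Submodule.exists_add_mem_mem_orthogonal (K := N) x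
    have hq0 : q ∈ (⨆ l, eigenspace (T : H →ₗ[ℂ] H) l)ᗮ := by
      rw [← Submodule.iInf_orthogonal, Submodule.mem_iInf]
      intro l
      by_cases hl0 : l = 0
      · rw [hl0]
        exact hq
      by_cases hev : HasEigenvalue (T : H →ₗ[ℂ] H) l
      · have hreal := hT.conj_eigenvalue_eq_self hev
        have hl : ((l.re : ℝ) : ℂ) = l := Complex.conj_eq_iff_re.1 hreal
        have hnn : 0 ≤ l.re := by
          refine eigenvalue_nonneg_of_nonneg (T := (T : H →ₗ[ℂ] H)) (𝕜 := ℂ) ?_ hpos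
          rw [RCLike.ofReal_eq_complex_ofReal, hl]
          exact hev
        have hlpos : 0 < l.re := lt_of_le_of_ne hnn fun h => hl0 (by rw [← hl, ← h]; rfl)
        rw [Submodule.mem_orthogonal]
        intro y hy
        have hxy : ⟪y, x⟫_ℂ = 0 :=
          (Submodule.mem_orthogonal _ _).1 hx y (hspan _ hlpos (by rw [hl]; exact hy))
        have hpy : ⟪y, p⟫_ℂ = 0 := by
          have h := hT y p
          simp only [ContinuousLinearMap.coe_coe] at h
          have hy' : T y = l • y := mem_eigenspace_iff.1 hy
          rw [hN.1 hp, inner_zero_right, hy', inner_smul_left, hreal] at h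
          exact (mul_eq_zero.1 h).resolve_left hl0
        rw [hpq, inner_add_right, hpy, zero_add] at hxy
        exact hxy
      · rw [HasEigenvalue, HasUnifEigenvalue, not_not] at hev
        change q ∈ (genEigenspace (T : H →ₗ[ℂ] H) l 1)ᗮ
        rw [hev]
        simp
    rw [ContinuousLinearMap.orthogonalComplement_iSup_eigenspaces_eq_bot hcomp hT,
      Submodule.mem_bot] at hq0
    rw [hpq, hq0, add_zero]
    exact hN.1 hp
  rintro _ ⟨v, rfl⟩
  have h : T v ∈ (Submodule.span ℂ (Set.range e))ᗮᗮ := by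
    rw [Submodule.mem_orthogonal]
    intro x hx
    have := hT x v
    simp only [ContinuousLinearMap.coe_coe] at this
    rw [← this, hker x hx, inner_zero_left]
  rw [Submodule.orthogonal_orthogonal_eq_closure] at h
  exact h

/-- A positive compact operator commuting with a conjugation `J` has an orthonormal family of
`J`-fixed eigenvectors which is a basis of each eigenspace with positive eigenvalue. -/
theorem LinearMap.IsSymmetric.exists_fixed_eigenbasis (hT : (T : H →ₗ[ℂ] H).IsSymmetric)
    (hcomp : IsCompactOperator T) (J : H →ₗ⋆[ℂ] H) (hJJ : ∀ u, J (J u) = u)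
    (hJ : ∀ u v, ⟪J u, J v⟫_ℂ = conj ⟪u, v⟫_ℂ) (hTJ : ∀ u, T (J u) = J (T u)) :
    ∃ (n : {l : ℝ // 0 < l} → ℕ) (b : (Σ l, Fin (n l)) → H), Orthonormal ℂ b ∧
      (∀ s, J (b s) = b s) ∧ (∀ s, T (b s) = ((s.1 : ℝ) : ℂ) • b s) ∧
      ∀ l, Submodule.span ℂ (Set.range fun k => b ⟨l, k⟩) =
        eigenspace (T : H →ₗ[ℂ] H) ((l : ℝ) : ℂ) := by
  have hex : ∀ l : {l : ℝ // 0 < l}, ∃ (n : ℕ) (b : Fin n → H), Orthonormal ℂ b ∧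
      (∀ k, J (b k) = b k) ∧
      Submodule.span ℂ (Set.range b) = eigenspace (T : H →ₗ[ℂ] H) ((l : ℝ) : ℂ) := by
    intro l
    have : FiniteDimensional ℂ (eigenspace (T : H →ₗ[ℂ] H) ((l : ℝ) : ℂ)) :=
      ContinuousLinearMap.finite_dimensional_eigenspace hcomp _
        (Complex.ofReal_ne_zero.2 l.2.ne')
    -- The eigenvalue is real, so conjugate-linearity of `J` leaves it unchanged and `J` preserves
    -- the eigenspace.
    refine exists_orthonormal_fixed_basis J hJJ hJ _ fun u hu => ?_
    have hu' : T u = ((l : ℝ) : ℂ) • u := mem_eigenspace_iff.1 hu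
    refine mem_eigenspace_iff.2 ?_
    rw [ContinuousLinearMap.coe_coe, hTJ, hu', map_smulₛₗ, Complex.conj_ofReal]
  choose n b hb hbJ hspan using hex
  have hmem : ∀ l k, T (b l k) = ((l : ℝ) : ℂ) • b l k := fun l k => by
    have : b l k ∈ eigenspace (T : H →ₗ[ℂ] H) ((l : ℝ) : ℂ) :=
      hspan l ▸ Submodule.subset_span ⟨k, rfl⟩
    exact mem_eigenspace_iff.1 this
  refine ⟨n, fun s => b s.1 s.2, ?_, fun s => hbJ _ _, fun s => hmem _ _, hspan⟩
  classical
  rw [orthonormal_iff_ite]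
  rintro ⟨l, j⟩ ⟨m, k⟩
  by_cases hlm : l = m
  · subst hlm
    have h := orthonormal_iff_ite.1 (hb l) j k
    simp only [h, Sigma.mk.injEq, heq_eq_eq, true_and]
  · have h := hT (b l j) (b m k)
    simp only [ContinuousLinearMap.coe_coe] at h
    rw [hmem, hmem, inner_smul_left, inner_smul_right, Complex.conj_ofReal] at h
    have h' : (((l : ℝ) : ℂ) - (m : ℝ)) * ⟪b l j, b m k⟫_ℂ = 0 := by rw [sub_mul, h, sub_self]
    have h0 := (mul_eq_zero.1 h').resolve_left
      (sub_ne_zero.2 fun h => hlm (Subtype.ext (Complex.ofReal_injective h)))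
    simp [h0, hlm]

/-- For each `l > 0` both families restrict to bases of the same eigenspace, so the index fibres
over `l` are equipotent; the bijections are glued over all `l`. -/
theorem LinearMap.IsSymmetric.exists_equiv_eigenbasis (hT : (T : H →ₗ[ℂ] H).IsSymmetric)
    (hcomp : IsCompactOperator T) {n : {l : ℝ // 0 < l} → ℕ} {b : (Σ l, Fin (n l)) → H}
    (hb : Orthonormal ℂ b)
    (hspan : ∀ l, Submodule.span ℂ (Set.range fun k => b ⟨l, k⟩) =
        eigenspace (T : H →ₗ[ℂ] H) ((l : ℝ) : ℂ))
    {α : ι → ℝ} {e : ι → H} (hα : ∀ i, 0 < α i) (he : Orthonormal ℂ e)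
    (heig : ∀ i, T (e i) = (α i : ℂ) • e i)
    (hrange : Set.range T ⊆ closure (Submodule.span ℂ (Set.range e) : Set H)) :
    ∃ φ : ι ≃ Σ l, Fin (n l), ∀ i, ((φ i).1 : ℝ) = α i := by
  let α' : ι → {l : ℝ // 0 < l} := fun i => ⟨α i, hα i⟩
  have hex : ∀ l : {l : ℝ // 0 < l}, Nonempty ({i // α' i = l} ≃ Fin (n l)) := by
    intro l
    have h1 := hT.span_eq_eigenspace hcomp heig hrange l.2.ne'
    have hli : LinearIndependent ℂ (fun i : {i // α i = l} => e i) :=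
      (he.comp _ Subtype.val_injective).linearIndependent
    have hli' : LinearIndependent ℂ (fun k => b ⟨l, k⟩) :=
      (hb.comp _ sigma_mk_injective).linearIndependent
    obtain ⟨ψ⟩ := hli.nonempty_equiv_of_span_eq hli' (h1.trans (hspan l).symm)
    exact ⟨(Equiv.subtypeEquivRight fun i => by simp [α', Subtype.ext_iff]).trans ψ⟩
  refine ⟨(Equiv.sigmaFiberEquiv α').symm.trans (Equiv.sigmaCongrRight fun l => (hex l).some), ?_⟩
  intro i
  rfl

end CompactOperator

/-! ### Covariance operator of a square-integrable random element. -/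

section CovarianceOperator

open scoped InnerProductSpace
open InnerProductSpace (rankOne)

variable {Ω H : Type*} [MeasurableSpace Ω] {P : Measure Ω}
  [NormedAddCommGroup H] [InnerProductSpace ℂ H] [CompleteSpace H]

/-- The covariance operator `v ↦ E[⟪g, v⟫ g]` of a random element `g` of a Hilbert space. -/
noncomputable def covOperator (P : Measure Ω) (g : Ω → H) : H →L[ℂ] H :=
  ∫ ω, rankOne ℂ (g ω) (g ω) ∂P

omit [CompleteSpace H] in
theorem integrable_rankOne_self {g : Ω → H} (hg : MemLp g 2 P) :
    Integrable (fun ω => rankOne ℂ (g ω) (g ω)) P := by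
  have hc : Continuous fun x : H => rankOne ℂ x x := by
    have h := (ContinuousLinearMap.smulRightL ℂ H H).continuous₂
    exact h.comp ((innerSL ℂ (E := H)).continuous.prodMk continuous_id)
  refine (hg.integrable_norm_pow (by norm_num)).mono (hc.comp_aestronglyMeasurable hg.1) ?_
  filter_upwards with ω
  rw [InnerProductSpace.norm_rankOne]
  simp [sq]

theorem inner_covOperator {g : Ω → H} (hg : MemLp g 2 P) (u v : H) :
    ⟪u, covOperator P g v⟫_ℂ = ∫ ω, ⟪u, g ω⟫_ℂ * ⟪g ω, v⟫_ℂ ∂P := by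
  have h := integrable_rankOne_self hg
  rw [covOperator, ContinuousLinearMap.integral_apply h,
    ← integral_inner (h.apply_continuousLinearMap v)]
  refine integral_congr_ae (Filter.Eventually.of_forall fun ω => ?_)
  simp only [InnerProductSpace.rankOne_apply, inner_smul_right]
  ring

theorem inner_covOperator_self {g : Ω → H} (hg : MemLp g 2 P) (v : H) :
    ⟪v, covOperator P g v⟫_ℂ = ((∫ ω, ‖⟪v, g ω⟫_ℂ‖ ^ 2 ∂P : ℝ) : ℂ) := by
  rw [inner_covOperator hg, ← integral_complex_ofReal]
  refine integral_congr_ae (Filter.Eventually.of_forall fun ω => ?_)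
  simp only
  rw [← inner_conj_symm (g ω) v, Complex.mul_conj, Complex.normSq_eq_norm_sq]

theorem isSymmetric_covOperator {g : Ω → H} (hg : MemLp g 2 P) :
    (covOperator P g : H →ₗ[ℂ] H).IsSymmetric := by
  intro u v
  simp only [ContinuousLinearMap.coe_coe]
  rw [← inner_conj_symm, inner_covOperator hg, inner_covOperator hg, ← integral_conj]
  refine integral_congr_ae (Filter.Eventually.of_forall fun ω => ?_)
  simp only [map_mul, inner_conj_symm]
  ring

theorem re_inner_covOperator_nonneg {g : Ω → H} (hg : MemLp g 2 P) (v : H) :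
    0 ≤ (⟪v, covOperator P g v⟫_ℂ).re := by
  rw [inner_covOperator_self hg, Complex.ofReal_re]
  exact integral_nonneg fun ω => by positivity

/-- Rank-one operators are compact, and an average over a probability measure stays in the closed
convex set of compact operators. -/
theorem isCompactOperator_covOperator [IsProbabilityMeasure P] {g : Ω → H} (hg : MemLp g 2 P) :
    IsCompactOperator (covOperator P g) := by
  have hcl : IsClosed {f : H →L[ℂ] H | IsCompactOperator f} :=
    isClosed_setOfPred_isCompactOperator
  have hconv : Convex ℝ {f : H →L[ℂ] H | IsCompactOperator f} :=
    ((compactOperator (RingHom.id ℂ) H H).restrictScalars ℝ).convex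
  refine hconv.integral_mem hcl (Filter.Eventually.of_forall fun ω => ?_)
    (integrable_rankOne_self hg)
  have h := (isCompactOperator_id (E := ℂ)).clm_comp (ContinuousLinearMap.toSpanSingleton ℂ (g ω))
  exact h.comp_clm (innerSL ℂ (g ω))

/-- Bessel's inequality under the expectation: the trace bound that makes the eigenvalues
enumerable. -/
theorem sum_inner_covOperator_le {g : Ω → H} (hg : MemLp g 2 P) (n : ℕ) (v : Fin n → H)
    (hv : Orthonormal ℂ v) :
    ∑ k, (⟪v k, covOperator P g (v k)⟫_ℂ).re ≤ ∫ ω, ‖g ω‖ ^ 2 ∂P := by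
  simp only [inner_covOperator_self hg, Complex.ofReal_re]
  have hint : ∀ k, Integrable (fun ω => ‖⟪v k, g ω⟫_ℂ‖ ^ 2) P := fun k =>
    (hg.const_inner (v k)).integrable_norm_pow (by norm_num)
  rw [← integral_finsetSum _ fun k _ => hint k]
  refine integral_mono (integrable_finsetSum _ fun k _ => hint k)
    (hg.integrable_norm_pow (by norm_num)) fun ω => ?_
  exact hv.sum_inner_products_le (g ω)

theorem covOperator_comm_conjugation {g : Ω → H} (hg : MemLp g 2 P) (J : H →ₗ⋆[ℂ] H)
    (hJJ : ∀ u, J (J u) = u) (hJ : ∀ u v, ⟪J u, J v⟫_ℂ = conj ⟪u, v⟫_ℂ)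
    (hJg : ∀ᵐ ω ∂P, J (g ω) = g ω) (v : H) :
    covOperator P g (J v) = J (covOperator P g v) := by
  refine ext_inner_left ℂ fun u => ?_
  have h1 : ⟪u, J (covOperator P g v)⟫_ℂ = conj ⟪J u, covOperator P g v⟫_ℂ := by
    rw [← hJ, hJJ]
  rw [h1, inner_covOperator hg, inner_covOperator hg, ← integral_conj]
  refine integral_congr_ae ?_
  filter_upwards [hJg] with ω hω
  rw [map_mul]
  congr 1
  · rw [← hJ, hJJ, hω]
  · rw [← hJ, hω]

/-- The random element lies almost surely in any closed subspace containing the range of its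
covariance operator. -/
theorem ae_mem_of_range_covOperator_subset [SecondCountableTopology H]
    {g : Ω → H} (hg : MemLp g 2 P) {K : Submodule ℂ H} (hK : IsClosed (K : Set H))
    (hrange : ∀ v, covOperator P g v ∈ K) : ∀ᵐ ω ∂P, g ω ∈ K := by
  have : CompleteSpace K := hK.completeSpace_coe
  -- Each `v ∈ Kᗮ` has its own null set; a countable dense set reduces them to one.
  obtain ⟨s, hs, hdense⟩ := TopologicalSpace.exists_countable_dense (Kᗮ : Submodule ℂ H)
  have h0 : ∀ v ∈ Kᗮ, ∀ᵐ ω ∂P, ⟪v, g ω⟫_ℂ = 0 := by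
    intro v hv
    have h1 := inner_covOperator_self hg v
    rw [(Submodule.mem_orthogonal' _ _).1 hv _ (hrange v)] at h1
    have h2 : ∫ ω, ‖⟪v, g ω⟫_ℂ‖ ^ 2 ∂P = 0 := by exact_mod_cast h1.symm
    rw [integral_eq_zero_iff_of_nonneg (fun ω => by positivity)
      ((hg.const_inner v).integrable_norm_pow (by norm_num))] at h2
    filter_upwards [h2] with ω hω
    simpa using hω
  have hall : ∀ᵐ ω ∂P, ∀ v ∈ s, ⟪(v : H), g ω⟫_ℂ = 0 :=
    (ae_ball_iff hs).2 fun v _ => h0 v v.2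
  filter_upwards [hall] with ω hω
  have hc : IsClosed {v : (Kᗮ : Submodule ℂ H) | ⟪(v : H), g ω⟫_ℂ = 0} :=
    isClosed_singleton.preimage (by fun_prop : Continuous fun v : (Kᗮ : Submodule ℂ H) =>
      ⟪(v : H), g ω⟫_ℂ)
  have huniv := hc.closure_subset_iff.2 hω
  rw [hdense.closure_eq] at huniv
  rw [← Submodule.orthogonal_orthogonal K, Submodule.mem_orthogonal]
  exact fun u hu => huniv (Set.mem_univ ⟨u, hu⟩)

/-- If every `⟪u, g⟫` is measurable, so is `g`. -/
theorem aestronglyMeasurable_of_inner [SecondCountableTopology H] {g : Ω → H}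
    (hg : ∀ u, AEStronglyMeasurable (fun ω => ⟪u, g ω⟫_ℂ) P) : AEStronglyMeasurable g P := by
  obtain ⟨w, b, hb⟩ := exists_hilbertBasis ℂ H
  have hw : Countable w := by
    -- Orthonormal vectors are at distance `√2 > 1`, so the balls of radius `1 / 2` around them are
    -- disjoint.
    refine Pairwise.countable_of_isOpen_disjoint (s := fun i => Metric.ball (b i) (1 / 2))
      (fun i j hij => Metric.ball_disjoint_ball ?_) (fun i => Metric.isOpen_ball)
      fun i => ⟨b i, Metric.mem_ball_self (by norm_num)⟩
    have h : dist (b i) (b j) ^ 2 = 2 := by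
      rw [dist_eq_norm, norm_sub_sq (𝕜 := ℂ), b.orthonormal.2 hij, b.orthonormal.1, b.orthonormal.1]
      norm_num
    nlinarith [dist_nonneg (x := b i) (y := b j)]
  refine aestronglyMeasurable_of_tendsto_ae (Filter.atTop : Filter (Finset w))
    (f := fun F ω => ∑ i ∈ F, ⟪b i, g ω⟫_ℂ • b i)
    (fun F => Finset.aestronglyMeasurable_fun_sum _ fun i _ => (hg (b i)).smul_const (b i)) ?_
  filter_upwards with ω
  have h := b.hasSum_repr (g ω)
  simp only [HilbertBasis.repr_apply_apply] at h
  exact h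

end CovarianceOperator

/-! ### Paths of the field as a random element of `L²(ρ)`. -/

section RandomLp

open scoped InnerProductSpace

variable {X Ω : Type*} [MeasurableSpace X] {ρ : Measure X} {G : X → Ω → ℂ}

theorem inner_toLp_right (u : Lp ℂ 2 ρ) {f : X → ℂ} (hf : MemLp f 2 ρ) :
    ⟪u, hf.toLp f⟫_ℂ = ∫ s, conj (u s) * f s ∂ρ := by
  rw [L2.inner_def]
  refine integral_congr_ae ?_
  filter_upwards [hf.coeFn_toLp] with s hs
  rw [hs, RCLike.inner_apply, mul_comm]

open Classical in
/-- The paths of a random field, as a random element of `L²(ρ)`. -/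
noncomputable def randomLp (ρ : Measure X) (G : X → Ω → ℂ) (ω : Ω) : Lp ℂ 2 ρ :=
  if h : MemLp (fun t => G t ω) 2 ρ then h.toLp _ else 0

theorem inner_randomLp (u : Lp ℂ 2 ρ) {ω : Ω} (h : MemLp (fun t => G t ω) 2 ρ) :
    ⟪u, randomLp ρ G ω⟫_ℂ = ∫ s, conj (u s) * G s ω ∂ρ := by
  rw [randomLp, dif_pos h, inner_toLp_right]

theorem coeFn_randomLp {ω : Ω} (h : MemLp (fun t => G t ω) 2 ρ) :
    randomLp ρ G ω =ᵐ[ρ] fun t => G t ω := by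
  rw [randomLp, dif_pos h]
  exact h.coeFn_toLp

theorem enorm_sq_toLp {f : X → ℂ} (hf : MemLp f 2 ρ) :
    ‖hf.toLp f‖ₑ ^ 2 = ∫⁻ t, ‖f t‖ₑ ^ 2 ∂ρ := by
  have h := eLpNorm_nnreal_pow_eq_lintegral (f := f) (μ := ρ) (p := 2) two_ne_zero
  rw [Lp.enorm_toLp]
  simpa using h

theorem norm_sq_randomLp {ω : Ω} (h : MemLp (fun t => G t ω) 2 ρ) :
    ‖randomLp ρ G ω‖ ^ 2 = ∫ t, ‖G t ω‖ ^ 2 ∂ρ := by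
  rw [randomLp, dif_pos h, ← inner_self_eq_norm_sq (𝕜 := ℂ), inner_toLp_right]
  have : ∀ᵐ t ∂ρ, conj (h.toLp (fun t => G t ω) t) * G t ω = ((‖G t ω‖ ^ 2 : ℝ) : ℂ) := by
    filter_upwards [h.coeFn_toLp] with t ht
    rw [ht, Complex.conj_mul']
    push_cast
    rfl
  rw [integral_congr_ae this, integral_complex_ofReal]
  exact Complex.ofReal_re _

variable [MeasurableSpace Ω] {P : Measure Ω}

section

variable [SFinite ρ] [SFinite P]

/-- By Fubini, the default value `0` in `randomLp` is used only on a null set. -/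
theorem MeasureTheory.MemLp.ae_memLp_section (hG : MemLp (fun p : X × Ω => G p.1 p.2) 2 (ρ.prod P))
    (hm : Measurable fun p : X × Ω => G p.1 p.2) : ∀ᵐ ω ∂P, MemLp (fun t => G t ω) 2 ρ := by
  rw [memLp_two_iff_integrable_sq_norm hG.1] at hG
  filter_upwards [hG.prod_left_ae] with ω hω
  have hmω : Measurable fun t => G t ω := hm.comp (measurable_id.prodMk measurable_const)
  exact (memLp_two_iff_integrable_sq_norm hmω.aestronglyMeasurable).2 hω

omit [SFinite ρ] [SFinite P] in
theorem MeasureTheory.MemLp.tensor {u : X → ℂ} {Y : Ω → ℂ} (hu : MemLp u 2 ρ)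
    (hY : MemLp Y 2 P) : MemLp (fun p : X × Ω => u p.1 * Y p.2) 2 (ρ.prod P) := by
  have h : AEStronglyMeasurable (fun p : X × Ω => u p.1 * Y p.2) (ρ.prod P) :=
    hu.1.comp_fst.mul hY.1.comp_snd
  rw [memLp_two_iff_integrable_sq_norm h]
  simp only [norm_mul, mul_pow]
  exact ((memLp_two_iff_integrable_sq_norm hu.1).1 hu).mul_prod
    ((memLp_two_iff_integrable_sq_norm hY.1).1 hY)

/-- Fubini's theorem for `E[Y ⟪u, G⟫]`. -/
theorem integral_mul_inner_randomLp (hG : MemLp (fun p : X × Ω => G p.1 p.2) 2 (ρ.prod P))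
    (hm : Measurable fun p : X × Ω => G p.1 p.2) (u : Lp ℂ 2 ρ) {Y : Ω → ℂ} (hY : MemLp Y 2 P) :
    ∫ ω, Y ω * ⟪u, randomLp ρ G ω⟫_ℂ ∂P = ∫ s, conj (u s) * ∫ ω, Y ω * G s ω ∂P ∂ρ := by
  have hu : MemLp (fun s => conj (u s)) 2 ρ := (Lp.memLp u).star
  have hint : Integrable (fun p : X × Ω => conj (u p.1) * Y p.2 * G p.1 p.2) (ρ.prod P) :=
    (hu.tensor hY).integrable_mul hG
  calc ∫ ω, Y ω * ⟪u, randomLp ρ G ω⟫_ℂ ∂P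
      = ∫ ω, ∫ s, conj (u s) * Y ω * G s ω ∂ρ ∂P := by
        refine integral_congr_ae ?_
        filter_upwards [hG.ae_memLp_section hm] with ω hω
        rw [inner_randomLp u hω, ← integral_const_mul]
        refine integral_congr_ae (Filter.Eventually.of_forall fun s => ?_)
        simp only
        ring
    _ = ∫ s, ∫ ω, conj (u s) * Y ω * G s ω ∂P ∂ρ := (integral_integral_swap hint).symm
    _ = ∫ s, conj (u s) * ∫ ω, Y ω * G s ω ∂P ∂ρ := by
        simp only [mul_assoc, integral_const_mul]

theorem lintegral_enorm_sq_randomLp (hG : MemLp (fun p : X × Ω => G p.1 p.2) 2 (ρ.prod P))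
    (hm : Measurable fun p : X × Ω => G p.1 p.2) :
    ∫⁻ ω, ‖randomLp ρ G ω‖ₑ ^ 2 ∂P = ∫⁻ t, ∫⁻ ω, ‖G t ω‖ₑ ^ 2 ∂P ∂ρ := by
  rw [lintegral_lintegral_swap (by fun_prop)]
  refine lintegral_congr_ae ?_
  filter_upwards [hG.ae_memLp_section hm] with ω hω
  rw [randomLp, dif_pos hω, enorm_sq_toLp]

theorem memLp_randomLp [SecondCountableTopology (Lp ℂ 2 ρ)]
    (hG : MemLp (fun p : X × Ω => G p.1 p.2) 2 (ρ.prod P))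
    (hm : Measurable fun p : X × Ω => G p.1 p.2) : MemLp (randomLp ρ G) 2 P := by
  refine ⟨aestronglyMeasurable_of_inner fun u => ?_, ?_⟩
  · have h : AEStronglyMeasurable (fun ω => ∫ s, conj (u s) * G s ω ∂ρ) P := by
      have hu : AEStronglyMeasurable (fun s => conj (u s)) ρ := (Lp.memLp u).star.1
      exact (hu.comp_fst.mul hG.1).prod_swap.integral_prod_right'
    refine h.congr ?_
    filter_upwards [hG.ae_memLp_section hm] with ω hω
    rw [inner_randomLp u hω]
  · have h := eLpNorm_nnreal_pow_eq_lintegral (f := randomLp ρ G) (μ := P) (p := 2) two_ne_zero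
    have h' := eLpNorm_nnreal_pow_eq_lintegral (f := fun p : X × Ω => G p.1 p.2)
      (μ := ρ.prod P) (p := 2) two_ne_zero
    simp only [NNReal.coe_ofNat, ENNReal.coe_ofNat, ENNReal.rpow_ofNat] at h h'
    rw [lintegral_enorm_sq_randomLp hG hm] at h
    rw [lintegral_prod _ (by fun_prop)] at h'
    have h2 := h.trans h'.symm
    have h3 : eLpNorm (randomLp ρ G) 2 P ^ 2 < ⊤ := by
      rw [h2]
      exact ENNReal.pow_lt_top hG.2
    exact (ENNReal.pow_lt_top_iff.1 h3).resolve_right two_ne_zero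

omit [SFinite ρ] in
theorem MeasureTheory.MemLp.integral_mul_section
    (hG : MemLp (fun p : X × Ω => G p.1 p.2) 2 (ρ.prod P))
    (hm : Measurable fun p : X × Ω => G p.1 p.2) {Y : Ω → ℂ} (hY : MemLp Y 2 P) :
    MemLp (fun s => ∫ ω, Y ω * G s ω ∂P) 2 ρ := by
  refine ⟨(hY.1.comp_snd.mul hG.1).integral_prod_right', ?_⟩
  rw [eLpNorm_lt_top_iff_lintegral_rpow_enorm_lt_top (by norm_num) (by norm_num)]
  have hG2 := (eLpNorm_lt_top_iff_lintegral_rpow_enorm_lt_top (by norm_num) (by norm_num)).1 hG.2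
  have hY2 := (eLpNorm_lt_top_iff_lintegral_rpow_enorm_lt_top (by norm_num) (by norm_num)).1 hY.2
  have hGm : AEMeasurable (fun p : X × Ω => ‖G p.1 p.2‖ₑ ^ (2 : ENNReal).toReal) (ρ.prod P) := by
    fun_prop
  rw [lintegral_prod _ hGm] at hG2
  calc ∫⁻ s, ‖∫ ω, Y ω * G s ω ∂P‖ₑ ^ (2 : ENNReal).toReal ∂ρ
      ≤ ∫⁻ s, (∫⁻ ω, ‖Y ω‖ₑ ^ (2 : ENNReal).toReal ∂P) *
          (∫⁻ ω, ‖G s ω‖ₑ ^ (2 : ENNReal).toReal ∂P) ∂ρ := by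
        refine lintegral_mono fun s => ?_
        have h1 : ‖∫ ω, Y ω * G s ω ∂P‖ₑ ≤ ∫⁻ ω, ‖Y ω‖ₑ * ‖G s ω‖ₑ ∂P := by
          refine (enorm_integral_le_lintegral_enorm _).trans_eq ?_
          simp only [enorm_mul]
        have hs : Measurable (G s) := hm.comp (measurable_const.prodMk measurable_id)
        have h2 := ENNReal.lintegral_mul_le_Lp_mul_Lq P Real.HolderConjugate.two_two
          hY.1.enorm hs.enorm.aemeasurable
        have h3 := ENNReal.rpow_le_rpow (h1.trans h2) (zero_le_two (α := ℝ))
        rw [ENNReal.mul_rpow_of_nonneg _ _ zero_le_two, ← ENNReal.rpow_mul,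
          ← ENNReal.rpow_mul] at h3
        simpa using h3
    _ < ⊤ := by
        rw [lintegral_const_mul'' _ hGm.lintegral_prod_right']
        exact ENNReal.mul_lt_top hY2 hG2

/-- Both sides have the same inner product with every `u`, by Fubini. For an eigenvector this
expresses `α_i e_i(s)` as a covariance with `G(s)`. -/
theorem coeFn_covOperator_randomLp [SecondCountableTopology (Lp ℂ 2 ρ)]
    (hG : MemLp (fun p : X × Ω => G p.1 p.2) 2 (ρ.prod P))
    (hm : Measurable fun p : X × Ω => G p.1 p.2) (v : Lp ℂ 2 ρ) :
    covOperator P (randomLp ρ G) v =ᵐ[ρ] fun s => ∫ ω, ⟪randomLp ρ G ω, v⟫_ℂ * G s ω ∂P := by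
  have hg := memLp_randomLp hG hm
  have hv : MemLp (fun ω => ⟪randomLp ρ G ω, v⟫_ℂ) 2 P := hg.inner_const v
  have hmem := hG.integral_mul_section hm hv
  have heq : hmem.toLp _ = covOperator P (randomLp ρ G) v := by
    refine ext_inner_left ℂ fun u => ?_
    rw [inner_toLp_right, inner_covOperator hg, ← integral_mul_inner_randomLp hG hm u hv]
    simp only [mul_comm]
  rw [← heq]
  exact hmem.coeFn_toLp

/-- The covariance operator of the random path is the integral operator whose kernel is the
covariance kernel. -/
theorem kernelOperator_covKernel [SecondCountableTopology (Lp ℂ 2 ρ)]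
    (hG : MemLp (fun p : X × Ω => G p.1 p.2) 2 (ρ.prod P))
    (hm : Measurable fun p : X × Ω => G p.1 p.2) (h2 : ∀ t, MemLp (G t) 2 P)
    (h0 : ∀ t, ∫ ω, G t ω ∂P = 0) (v : Lp ℂ 2 ρ) :
    kernelOperator ρ (covKernel P G) v = covOperator P (randomLp ρ G) v := by
  have hker : kernelIntegral ρ (covKernel P G) v =
      fun s => ∫ ω, ⟪randomLp ρ G ω, v⟫_ℂ * G s ω ∂P := by
    funext s
    -- With `Y = conj (G s)`, the conjugate of this identity is the kernel integral at the point
    -- `s`.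
    have h := integral_mul_inner_randomLp hG hm v (Y := fun ω => conj (G s ω)) (h2 s).star
    have h' := congrArg conj h
    rw [← integral_conj, ← integral_conj] at h'
    rw [kernelIntegral]
    refine Eq.trans ?_ (h'.symm.trans ?_)
    · refine integral_congr_ae (Filter.Eventually.of_forall fun t => ?_)
      simp only [covKernel, h0, sub_zero, map_mul, Complex.conj_conj]
      rw [← integral_conj, mul_comm]
      simp only [map_mul, Complex.conj_conj]
    · refine integral_congr_ae (Filter.Eventually.of_forall fun ω => ?_)
      simp only [map_mul, Complex.conj_conj, inner_conj_symm]
      rw [mul_comm]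
  have hae := coeFn_covOperator_randomLp hG hm v
  have hmem : MemLp (kernelIntegral ρ (covKernel P G) v) 2 ρ := by
    rw [hker]
    exact (Lp.memLp _).ae_eq hae
  rw [kernelOperator, dif_pos hmem]
  refine Lp.ext (hmem.coeFn_toLp.trans ?_)
  rw [hker]
  exact hae.symm

end

/-! ### The conjugation given by reflection, and hermiticity of the paths. -/

section Reflection

variable [InvolutiveNeg X] [MeasurableNeg X] [ρ.IsNegInvariant]

theorem coeFn_star_compMeasurePreserving_neg (u : Lp ℂ 2 ρ) :
    (star (Lp.compMeasurePreserving Neg.neg (Measure.measurePreserving_neg ρ) u) : Lp ℂ 2 ρ)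
      =ᵐ[ρ] fun t => conj (u (-t)) := by
  filter_upwards [Lp.coeFn_star (Lp.compMeasurePreserving Neg.neg
      (Measure.measurePreserving_neg ρ) u),
    Lp.coeFn_compMeasurePreserving u (Measure.measurePreserving_neg ρ)] with t h1 h2
  rw [h1, Pi.star_apply, h2]
  rfl

variable (ρ) in
/-- The conjugation `u ↦ conj (u (-t))` of `L²(ρ)`. -/
noncomputable def reflConj : Lp ℂ 2 ρ →ₗ⋆[ℂ] Lp ℂ 2 ρ where
  toFun u := star (Lp.compMeasurePreserving Neg.neg (Measure.measurePreserving_neg ρ) u)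
  map_add' u v := by
    refine Lp.ext ?_
    filter_upwards [coeFn_star_compMeasurePreserving_neg (u + v),
      coeFn_star_compMeasurePreserving_neg u, coeFn_star_compMeasurePreserving_neg v,
      (Measure.measurePreserving_neg ρ).quasiMeasurePreserving.ae (Lp.coeFn_add u v),
      Lp.coeFn_add (star (Lp.compMeasurePreserving Neg.neg (Measure.measurePreserving_neg ρ) u))
        (star (Lp.compMeasurePreserving Neg.neg (Measure.measurePreserving_neg ρ) v))]
      with t h1 h2 h3 h4 h5
    rw [h1, h5, h4, Pi.add_apply, Pi.add_apply, h2, h3, map_add]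
  map_smul' c u := by
    refine Lp.ext ?_
    filter_upwards [coeFn_star_compMeasurePreserving_neg (c • u),
      coeFn_star_compMeasurePreserving_neg u,
      (Measure.measurePreserving_neg ρ).quasiMeasurePreserving.ae (Lp.coeFn_smul c u),
      Lp.coeFn_smul (conj c)
        (star (Lp.compMeasurePreserving Neg.neg (Measure.measurePreserving_neg ρ) u))]
      with t h1 h2 h3 h4
    rw [h1, h4, h3, Pi.smul_apply, Pi.smul_apply, h2, smul_eq_mul, smul_eq_mul, map_mul]

theorem coeFn_reflConj (u : Lp ℂ 2 ρ) : reflConj ρ u =ᵐ[ρ] fun t => conj (u (-t)) :=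
  coeFn_star_compMeasurePreserving_neg u

theorem reflConj_reflConj (u : Lp ℂ 2 ρ) : reflConj ρ (reflConj ρ u) = u := by
  refine Lp.ext ?_
  filter_upwards [coeFn_reflConj (reflConj ρ u),
    (Measure.measurePreserving_neg ρ).quasiMeasurePreserving.ae (coeFn_reflConj u)] with t h1 h2
  rw [h1, h2, neg_neg, Complex.conj_conj]

theorem inner_reflConj (u v : Lp ℂ 2 ρ) : ⟪reflConj ρ u, reflConj ρ v⟫_ℂ = conj ⟪u, v⟫_ℂ := by
  rw [L2.inner_def, L2.inner_def, ← integral_conj,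
    ← (Measure.measurePreserving_neg ρ).integral_comp (MeasurableEquiv.neg X).measurableEmbedding]
  refine integral_congr_ae ?_
  filter_upwards [(Measure.measurePreserving_neg ρ).quasiMeasurePreserving.ae (coeFn_reflConj u),
    (Measure.measurePreserving_neg ρ).quasiMeasurePreserving.ae (coeFn_reflConj v)] with t h1 h2
  rw [h1, h2, neg_neg]
  simp

-- Expand `E|conj (G(-t)) - G(t)|²`. Hermiticity at `(t, t)` and `(-t, -t)` identifies `E|G(t)|²`
-- and `E|G(-t)|²` with `E[G(t) G(-t)]`, which is therefore real, and the four terms cancel.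
omit [MeasurableSpace X] [MeasurableNeg X] in
theorem ae_neg_eq_conj (h2 : ∀ t, MemLp (G t) 2 P)
    (hherm : ∀ s t, ∫ ω, G s ω * conj (G t ω) ∂P = ∫ ω, G s ω * G (-t) ω ∂P) (t : X) :
    ∀ᵐ ω ∂P, conj (G (-t) ω) = G t ω := by
  have hc : ∀ s, MemLp (fun ω => conj (G s ω)) 2 P := fun s => (h2 s).star
  have hD : MemLp (fun ω => conj (G (-t) ω) - G t ω) 2 P := (hc (-t)).sub (h2 t)
  have i1 : Integrable (fun ω => G (-t) ω * conj (G (-t) ω)) P := (h2 _).integrable_mul (hc _)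
  have i2 : Integrable (fun ω => G t ω * conj (G t ω)) P := (h2 _).integrable_mul (hc _)
  have i3 : Integrable (fun ω => G t ω * G (-t) ω) P := (h2 _).integrable_mul (h2 _)
  have i4 : Integrable (fun ω => conj (G t ω * G (-t) ω)) P := by
    simp only [map_mul]
    exact (hc t).integrable_mul (hc (-t))
  have e1 := hherm (-t) (-t)
  have e2 := hherm t t
  rw [neg_neg] at e1
  simp only [mul_comm (G (-t) _) (G t _)] at e1
  have e3 : conj (∫ ω, G t ω * conj (G t ω) ∂P) = ∫ ω, G t ω * conj (G t ω) ∂P := by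
    rw [← integral_conj]
    simp only [map_mul, Complex.conj_conj, mul_comm]
  have h : ((∫ ω, ‖conj (G (-t) ω) - G t ω‖ ^ 2 ∂P : ℝ) : ℂ) = 0 := by
    rw [← integral_complex_ofReal]
    calc ∫ ω, ((‖conj (G (-t) ω) - G t ω‖ ^ 2 : ℝ) : ℂ) ∂P
        = ∫ ω, (G (-t) ω * conj (G (-t) ω) + G t ω * conj (G t ω) - G t ω * G (-t) ω -
            conj (G t ω * G (-t) ω)) ∂P := by
          refine integral_congr_ae (Filter.Eventually.of_forall fun ω => ?_)
          simp only
          rw [← Complex.normSq_eq_norm_sq, ← Complex.mul_conj]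
          simp only [map_sub, map_mul, Complex.conj_conj]
          ring
      _ = 0 := by
          have i12 : Integrable (fun ω => G (-t) ω * conj (G (-t) ω) + G t ω * conj (G t ω)) P :=
            i1.add i2
          have i123 : Integrable (fun ω => G (-t) ω * conj (G (-t) ω) + G t ω * conj (G t ω) -
            G t ω * G (-t) ω) P := i12.sub i3
          rw [integral_sub i123 i4, integral_sub i12 i3, integral_add i1 i2, integral_conj, e1,
            ← e2, e3]
          ring
  have h' : ∫ ω, ‖conj (G (-t) ω) - G t ω‖ ^ 2 ∂P = 0 := by exact_mod_cast h
  rw [integral_eq_zero_iff_of_nonneg (fun ω => by positivity)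
    (hD.integrable_norm_pow (by norm_num))] at h'
  filter_upwards [h'] with ω hω
  simpa [sub_eq_zero] using hω

theorem ae_reflConj_randomLp [SFinite ρ] [SFinite P]
    (hG : MemLp (fun p : X × Ω => G p.1 p.2) 2 (ρ.prod P))
    (hm : Measurable fun p : X × Ω => G p.1 p.2)
    (hsym : ∀ t, ∀ᵐ ω ∂P, conj (G (-t) ω) = G t ω) :
    ∀ᵐ ω ∂P, reflConj ρ (randomLp ρ G ω) = randomLp ρ G ω := by
  have hmeas : MeasurableSet {p : X × Ω | conj (G (-p.1) p.2) = G p.1 p.2} := by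
    refine measurableSet_eq_fun ?_ hm
    have : Measurable fun p : X × Ω => G (-p.1) p.2 :=
      hm.comp (measurable_fst.neg.prodMk measurable_snd)
    exact Complex.continuous_conj.measurable.comp this
  -- From "for each `t`, almost surely" to "almost surely, for `ρ`-almost every `t`".
  have hswap := (Measure.ae_ae_comm (μ := ρ) (ν := P) hmeas).1 (Filter.Eventually.of_forall hsym)
  filter_upwards [hswap, hG.ae_memLp_section hm] with ω h1 h2
  refine Lp.ext ?_
  filter_upwards [h1, coeFn_randomLp h2, coeFn_reflConj (randomLp ρ G ω),
    (Measure.measurePreserving_neg ρ).quasiMeasurePreserving.ae (coeFn_randomLp h2)]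
    with t h3 h4 h5 h6
  rw [h5, h6, h3, h4]

end Reflection

end RandomLp

/-! ### Stability of centered Gaussian laws under `L²` limits. -/

section GaussianClosure

open scoped InnerProductSpace

variable {Ω : Type*} [MeasurableSpace Ω] {P : Measure Ω}

theorem norm_cexp_mul_I_sub_le (a b : ℝ) :
    ‖Complex.exp (a * Complex.I) - Complex.exp (b * Complex.I)‖ ≤ |a - b| := by
  have h : Complex.exp (a * Complex.I) - Complex.exp (b * Complex.I) =
      Complex.exp (b * Complex.I) * (Complex.exp (Complex.I * (a - b : ℝ)) - 1) := by
    rw [mul_sub, ← Complex.exp_add, mul_one]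
    congr 2
    push_cast
    ring
  rw [h, norm_mul, Complex.norm_exp_ofReal_mul_I, one_mul, ← Real.norm_eq_abs]
  exact Real.norm_exp_I_mul_ofReal_sub_one_le

/-- The map `x ↦ exp (i r x)` is `|r|`-Lipschitz, and the `L¹` norm is at most the `L²` norm on a
probability space. -/
theorem continuous_integral_cexp [IsProbabilityMeasure P] (r : ℝ) :
    Continuous fun X : Lp ℝ 2 P => ∫ ω, Complex.exp ((r * X ω : ℝ) * Complex.I) ∂P := by
  have hm : ∀ X : Lp ℝ 2 P,
      Integrable (fun ω => Complex.exp ((r * X ω : ℝ) * Complex.I)) P := fun X => by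
    refine Integrable.of_bound (C := 1) ?_ (Filter.Eventually.of_forall fun ω => ?_)
    · have hX := (Lp.memLp X).1
      exact (by fun_prop : Continuous fun x : ℝ => Complex.exp ((r * x : ℝ) * Complex.I)
        ).comp_aestronglyMeasurable hX
    · rw [Complex.norm_exp_ofReal_mul_I]
  refine (LipschitzWith.of_dist_le_mul (K := ‖r‖₊) fun X Y => ?_).continuous
  have hXY : Integrable (fun ω => (X - Y) ω) P := (Lp.memLp (X - Y)).integrable one_le_two
  have h1 : ∫ ω, ‖(X - Y) ω‖ ∂P ≤ ‖X - Y‖ := by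
    rw [integral_norm_eq_lintegral_enorm hXY.1, ← eLpNorm_one_eq_lintegral_enorm, Lp.norm_def]
    exact ENNReal.toReal_mono (Lp.memLp (X - Y)).2.ne
      (eLpNorm_le_eLpNorm_of_exponent_le one_le_two hXY.1)
  rw [dist_eq_norm, dist_eq_norm, ← integral_sub (hm X) (hm Y), coe_nnnorm]
  refine (norm_integral_le_of_norm_le (hXY.norm.const_mul ‖r‖) ?_).trans ?_
  · filter_upwards [Lp.coeFn_sub X Y] with ω hω
    refine (norm_cexp_mul_I_sub_le _ _).trans_eq ?_
    rw [hω, Pi.sub_apply, ← mul_sub, abs_mul, Real.norm_eq_abs, Real.norm_eq_abs]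
  · rw [integral_const_mul]
    gcongr

theorem map_eq_gaussianReal_iff [IsProbabilityMeasure P] {X : Ω → ℝ} (hX : AEMeasurable X P)
    (v : NNReal) : P.map X = gaussianReal 0 v ↔
      ∀ r : ℝ, ∫ ω, Complex.exp ((r * X ω : ℝ) * Complex.I) ∂P =
        Complex.exp (-(v * r ^ 2 / 2 : ℝ)) := by
  have : IsProbabilityMeasure (P.map X) := Measure.isProbabilityMeasure_map hX
  have h1 : ∀ r : ℝ, charFun (P.map X) r =
      ∫ ω, Complex.exp ((r * X ω : ℝ) * Complex.I) ∂P := fun r => by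
    rw [charFun_apply_real, integral_map hX (by fun_prop)]
    push_cast
    rfl
  have h2 : ∀ r : ℝ, charFun (gaussianReal 0 v) r = Complex.exp (-(v * r ^ 2 / 2 : ℝ)) :=
    fun r => by
      rw [charFun_gaussianReal]
      congr 1
      push_cast
      ring
  refine ⟨fun h r => by rw [← h1, h, h2], fun h => Measure.ext_of_charFun ?_⟩
  funext r
  rw [h1, h2, h]

/-- Tested on characteristic functions, the condition equates two continuous functions of `X` for
each frequency `r`. -/
theorem isClosed_setOf_map_eq_gaussianReal [IsProbabilityMeasure P] :
    IsClosed {X : Lp ℝ 2 P | P.map X = gaussianReal 0 (‖X‖₊ ^ 2)} := by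
  have : {X : Lp ℝ 2 P | P.map X = gaussianReal 0 (‖X‖₊ ^ 2)} = ⋂ r : ℝ,
      {X : Lp ℝ 2 P | ∫ ω, Complex.exp ((r * X ω : ℝ) * Complex.I) ∂P =
        Complex.exp (-((‖X‖₊ ^ 2 : NNReal) * r ^ 2 / 2 : ℝ))} := by
    ext X
    rw [Set.mem_iInter]
    exact map_eq_gaussianReal_iff (Lp.memLp X).1.aemeasurable _
  rw [this]
  refine isClosed_iInter fun r => isClosed_eq (continuous_integral_cexp r) ?_
  fun_prop

theorem integral_sq_eq_norm_sq {f : Ω → ℝ} (hf : MemLp f 2 P) :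
    ∫ ω, f ω ^ 2 ∂P = ‖hf.toLp f‖ ^ 2 := by
  rw [← real_inner_self_eq_norm_sq, L2.inner_def]
  refine integral_congr_ae ?_
  filter_upwards [hf.coeFn_toLp] with ω hω
  rw [hω, real_inner_self_eq_norm_sq, Real.norm_eq_abs, sq_abs]

theorem ProbabilityTheory.HasGaussianLaw.map_eq_gaussianReal_norm {f : Ω → ℝ}
    (hf : HasGaussianLaw f P) (h0 : ∫ ω, f ω ∂P = 0) :
    P.map (hf.memLp_two.toLp f) = gaussianReal 0 (‖hf.memLp_two.toLp f‖₊ ^ 2) := by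
  have := hf.isProbabilityMeasure
  rw [Measure.map_congr hf.memLp_two.coeFn_toLp, hf.map_eq_gaussianReal, h0]
  congr 1
  rw [variance_of_integral_eq_zero hf.aemeasurable h0, integral_sq_eq_norm_sq hf.memLp_two]
  exact Real.toNNReal_coe (r := ‖hf.memLp_two.toLp f‖₊ ^ 2)

/-- The closed linear span in `L²` of a centered Gaussian process consists of Gaussian
variables. -/
theorem ProbabilityTheory.IsGaussianProcess.map_eq_gaussianReal_of_mem_closure {κ : Type*}
    {W : κ → Ω → ℝ} (hW : IsGaussianProcess W P) (h0 : ∀ k, ∫ ω, W k ω ∂P = 0) {X : Lp ℝ 2 P}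
    (hX : X ∈ (Submodule.span ℝ (Set.range fun k =>
      (hW.hasGaussianLaw_eval k).memLp_two.toLp (W k))).topologicalClosure) :
    P.map X = gaussianReal 0 (‖X‖₊ ^ 2) := by
  have := hW.isProbabilityMeasure
  refine (closure_minimal ?_ isClosed_setOf_map_eq_gaussianReal) hX
  intro Y hY
  obtain ⟨c, rfl⟩ := (Finsupp.mem_span_range_iff_exists_finsupp).1 hY
  let f : Ω → ℝ := fun ω => ∑ k ∈ c.support, c k • W k ω
  have hf : HasGaussianLaw f P := (hW.smul c).hasGaussianLaw_fun_sum
  have hf0 : ∫ ω, f ω ∂P = 0 := by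
    have hi : ∀ k, Integrable (fun ω => c k • W k ω) P := fun k =>
      (hW.hasGaussianLaw_eval k).integrable.smul (c k)
    rw [integral_finsetSum _ fun k _ => hi k]
    refine Finset.sum_eq_zero fun k _ => ?_
    rw [integral_smul, h0, smul_zero]
  have heq : hf.memLp_two.toLp f =
      c.sum fun k a => a • (hW.hasGaussianLaw_eval k).memLp_two.toLp (W k) := by
    rw [Finsupp.sum]
    refine Lp.ext ?_
    have hall : ∀ᵐ ω ∂P, ∀ k ∈ c.support,
        (c k • (hW.hasGaussianLaw_eval k).memLp_two.toLp (W k) : Lp ℝ 2 P) ω = c k • W k ω :=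
      (Filter.eventually_all_finset _).2 fun k _ => by
        filter_upwards [Lp.coeFn_smul (c k) ((hW.hasGaussianLaw_eval k).memLp_two.toLp (W k)),
          (hW.hasGaussianLaw_eval k).memLp_two.coeFn_toLp] with ω h1 h2
        rw [h1, Pi.smul_apply, h2]
    filter_upwards [hf.memLp_two.coeFn_toLp, hall, Lp.coeFn_fun_finsetSum c.support fun k =>
      c k • (hW.hasGaussianLaw_eval k).memLp_two.toLp (W k)] with ω h1 h2 h3
    rw [h1, h3]
    exact (Finset.sum_congr rfl h2).symm
  rw [← heq]
  exact hf.map_eq_gaussianReal_norm hf0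

end GaussianClosure

/-! ### Gaussianity of the real coordinates of the path. -/

section RandomLpGaussian

open scoped InnerProductSpace

variable {X Ω : Type*} [MeasurableSpace X] [MeasurableSpace Ω] {ρ : Measure X} {P : Measure Ω}
  {G : X → Ω → ℂ} [SFinite ρ] [SecondCountableTopology (Lp ℂ 2 ρ)]

/-- The variable lies in the closed real span of all `Re G(t)` and `Im G(t)`. Duality shows this
without approximating the integral: if `Y` is orthogonal to that span, then `E[Y G(t)] = 0` for all
`t`, hence `E[Y ⟪u, g⟫] = 0` by Fubini. -/
theorem map_re_inner_randomLp (hG : MemLp (fun p : X × Ω => G p.1 p.2) 2 (ρ.prod P))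
    (hm : Measurable fun p : X × Ω => G p.1 p.2) (hgauss : IsGaussianProcess G P)
    (h0 : ∀ t, ∫ ω, G t ω ∂P = 0) (u : Lp ℂ 2 ρ) :
    P.map (fun ω => (⟪u, randomLp ρ G ω⟫_ℂ).re) =
      gaussianReal 0 (∫ ω, (⟪u, randomLp ρ G ω⟫_ℂ).re ^ 2 ∂P).toNNReal := by
  have := hgauss.isProbabilityMeasure
  let W : X ⊕ X → Ω → ℝ := Sum.elim (fun t ω => (G t ω).re) (fun t ω => (G t ω).im)
  have hW : IsGaussianProcess W P := by
    refine hgauss.of_isGaussianProcess ?_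
    rintro (t | t)
    · exact ⟨{t}, Complex.reCLM ∘L ContinuousLinearMap.proj ⟨t, Finset.mem_singleton_self t⟩,
        fun ω => rfl⟩
    · exact ⟨{t}, Complex.imCLM ∘L ContinuousLinearMap.proj ⟨t, Finset.mem_singleton_self t⟩,
        fun ω => rfl⟩
  have hGi : ∀ t, Integrable (G t) P := fun t => (hgauss.hasGaussianLaw_eval t).integrable
  have hW0 : ∀ k, ∫ ω, W k ω ∂P = 0 := by
    rintro (t | t)
    · have h := integral_re (hGi t)
      rw [h0] at h
      exact h
    · have h := integral_im (hGi t)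
      rw [h0] at h
      exact h
  have hU : MemLp (fun ω => (⟪u, randomLp ρ G ω⟫_ℂ).re) 2 P :=
    ((memLp_randomLp hG hm).const_inner (𝕜 := ℂ) u).re
  have hUc : hU.toLp _ ∈ (Submodule.span ℝ (Set.range fun k =>
      (hW.hasGaussianLaw_eval k).memLp_two.toLp (W k))).topologicalClosure := by
    rw [← Submodule.orthogonal_orthogonal_eq_closure, Submodule.mem_orthogonal]
    intro Y hY
    have hYW : ∀ k, ∫ ω, Y ω * W k ω ∂P = 0 := by
      intro k
      have h := (Submodule.mem_orthogonal' _ _).1 hY _ (Submodule.subset_span ⟨k, rfl⟩)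
      rw [L2.inner_def] at h
      rw [← h]
      refine integral_congr_ae ?_
      filter_upwards [(hW.hasGaussianLaw_eval k).memLp_two.coeFn_toLp] with ω hω
      rw [hω]
      simp [mul_comm]
    have hYc : MemLp (fun ω => (Y ω : ℂ)) 2 P := (Lp.memLp Y).ofReal
    have hYG : ∀ t, ∫ ω, (Y ω : ℂ) * G t ω ∂P = 0 := by
      intro t
      have hi : Integrable (fun ω => (Y ω : ℂ) * G t ω) P :=
        hYc.integrable_mul (hgauss.hasGaussianLaw_eval t).memLp_two
      apply Complex.ext
      · have h := integral_re hi
        simp only [RCLike.re_eq_complex_re, Complex.re_ofReal_mul] at h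
        rw [← h]
        exact hYW (Sum.inl t)
      · have h := integral_im hi
        simp only [RCLike.im_eq_complex_im, Complex.im_ofReal_mul] at h
        rw [← h]
        exact hYW (Sum.inr t)
    have h := integral_mul_inner_randomLp hG hm u hYc
    simp only [hYG, mul_zero, integral_zero] at h
    have hi : Integrable (fun ω => (Y ω : ℂ) * ⟪u, randomLp ρ G ω⟫_ℂ) P :=
      hYc.integrable_mul ((memLp_randomLp hG hm).const_inner u)
    have h' := integral_re hi
    rw [h] at h'
    simp only [RCLike.re_eq_complex_re, Complex.re_ofReal_mul, Complex.zero_re] at h'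
    rw [L2.inner_def, ← h']
    refine integral_congr_ae ?_
    filter_upwards [hU.coeFn_toLp] with ω hω
    rw [hω]
    simp [mul_comm]
  rw [← Measure.map_congr hU.coeFn_toLp, hW.map_eq_gaussianReal_of_mem_closure hW0 hUc,
    integral_sq_eq_norm_sq hU]
  congr 1
  exact (Real.toNNReal_coe (r := ‖hU.toLp _‖₊ ^ 2)).symm

end RandomLpGaussian

/-! ### Parseval under the expectation and normalized coordinates. -/

section Expansion

open scoped InnerProductSpace

theorem hasSum_norm_sq_iff_tsum_enorm_sq {ι E F : Type*} [NormedAddCommGroup E]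
    [NormedAddCommGroup F] {f : ι → E} {x : F} :
    HasSum (fun i => ‖f i‖ ^ 2) (‖x‖ ^ 2) ↔ ∑' i, ‖f i‖ₑ ^ 2 = ‖x‖ₑ ^ 2 := by
  have h1 : HasSum (fun i => ‖f i‖ ^ 2) (‖x‖ ^ 2) ↔
      HasSum (fun i => ‖f i‖₊ ^ 2) (‖x‖₊ ^ 2) := by
    rw [← NNReal.hasSum_coe]
    simp
  have h2 : HasSum (fun i => ‖f i‖₊ ^ 2) (‖x‖₊ ^ 2) ↔
      HasSum (fun i => ‖f i‖ₑ ^ 2) (‖x‖ₑ ^ 2) := by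
    rw [← ENNReal.hasSum_coe]
    simp [enorm_eq_nnnorm]
  rw [h1, h2]
  exact ENNReal.summable.hasSum_iff

theorem Orthonormal.tsum_enorm_sq_le {ι H : Type*} [NormedAddCommGroup H]
    [InnerProductSpace ℂ H] {e : ι → H} (he : Orthonormal ℂ e) (x : H) :
    ∑' i, ‖⟪e i, x⟫_ℂ‖ₑ ^ 2 ≤ ‖x‖ₑ ^ 2 := by
  refine ENNReal.summable.tsum_le_of_sum_le fun F => ?_
  have h := he.sum_inner_products_le x (s := F)
  have h' : ∑ i ∈ F, ‖⟪e i, x⟫_ℂ‖₊ ^ 2 ≤ ‖x‖₊ ^ 2 := by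
    rw [← NNReal.coe_le_coe]
    simpa using h
  simp only [enorm_eq_nnnorm]
  exact_mod_cast h'

variable {ι Ω H : Type*} [MeasurableSpace Ω] {P : Measure Ω} [NormedAddCommGroup H]
  [InnerProductSpace ℂ H] [CompleteSpace H]

theorem lintegral_enorm_sq_inner_of_eigenvector {g : Ω → H} (hg : MemLp g 2 P) {a : ℝ} {v : H}
    (hv : ‖v‖ = 1) (heig : covOperator P g v = (a : ℂ) • v) :
    ∫⁻ ω, ‖⟪v, g ω⟫_ℂ‖ₑ ^ 2 ∂P = ENNReal.ofReal a := by
  have h := inner_covOperator_self hg v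
  rw [heig, inner_smul_right, inner_self_eq_norm_sq_to_K, hv] at h
  have ha : a = ∫ ω, ‖⟪v, g ω⟫_ℂ‖ ^ 2 ∂P := by
    apply Complex.ofReal_injective
    rw [← h]
    simp
  rw [ha, ofReal_integral_eq_lintegral_ofReal ((hg.const_inner v).integrable_norm_pow (by norm_num))
    (Filter.Eventually.of_forall fun ω => by positivity)]
  simp only [ENNReal.ofReal_pow (norm_nonneg _), ofReal_norm]

theorem lintegral_enorm_sq_eq_tsum_eigenvalue [Countable ι] {g : Ω → H} (hg : MemLp g 2 P)
    {α : ι → ℝ} {e : ι → H} (he : Orthonormal ℂ e)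
    (heig : ∀ i, covOperator P g (e i) = (α i : ℂ) • e i)
    (hmem : ∀ᵐ ω ∂P, g ω ∈ (Submodule.span ℂ (Set.range e)).topologicalClosure) :
    ∫⁻ ω, ‖g ω‖ₑ ^ 2 ∂P = ∑' i, ENNReal.ofReal (α i) := by
  have h : ∀ᵐ ω ∂P, ‖g ω‖ₑ ^ 2 = ∑' i, ‖⟪e i, g ω⟫_ℂ‖ₑ ^ 2 := by
    filter_upwards [hmem] with ω hω
    exact (hasSum_norm_sq_iff_tsum_enorm_sq.1 (he.hasSum_norm_sq_of_mem_closure hω)).symm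
  rw [lintegral_congr_ae h, lintegral_tsum fun i => (hg.const_inner (e i)).1.enorm.pow_const 2]
  exact tsum_congr fun i => lintegral_enorm_sq_inner_of_eigenvector hg (he.1 i) (heig i)

/-- The covariance of the coordinates `⟪e i, g⟫` and `⟪e j, g⟫` is a matrix entry of the covariance
operator, which is diagonal in `e`. -/
theorem orthonormal_inner_div_sqrt {g : Ω → H} (hg : MemLp g 2 P)
    {α : ι → ℝ} {e : ι → H} (hα : ∀ i, 0 < α i) (he : Orthonormal ℂ e)
    (heig : ∀ i, covOperator P g (e i) = (α i : ℂ) • e i) :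
    Orthonormal ℂ fun i => ((√(α i))⁻¹ : ℂ) •
      (hg.const_inner (𝕜 := ℂ) (e i)).toLp (fun ω => ⟪e i, g ω⟫_ℂ) := by
  classical
  rw [orthonormal_iff_ite]
  intro i j
  have h : ⟪(hg.const_inner (𝕜 := ℂ) (e i)).toLp (fun ω => ⟪e i, g ω⟫_ℂ),
      (hg.const_inner (𝕜 := ℂ) (e j)).toLp (fun ω => ⟪e j, g ω⟫_ℂ)⟫_ℂ =
      α i * ⟪e j, e i⟫_ℂ := by
    rw [← inner_smul_right, ← heig, inner_covOperator hg, inner_toLp_right]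
    refine integral_congr_ae ?_
    filter_upwards [(hg.const_inner (𝕜 := ℂ) (e i)).coeFn_toLp] with ω hω
    rw [hω, inner_conj_symm, mul_comm]
  rw [inner_smul_left, inner_smul_right, h, orthonormal_iff_ite.1 he]
  by_cases hij : i = j
  · subst hij
    have hs : (√(α i) : ℂ) * √(α i) = α i := by
      rw [← Complex.ofReal_mul, Real.mul_self_sqrt (hα i).le]
    have hs0 : (√(α i) : ℂ) ≠ 0 := Complex.ofReal_ne_zero.2 (Real.sqrt_pos.2 (hα i)).ne'
    simp only [if_true, mul_one]
    rw [← hs, map_inv₀, Complex.conj_ofReal]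
    field_simp
  · rw [if_neg hij, if_neg (Ne.symm hij)]
    simp

end Expansion

/-! ### Mercer's representation almost everywhere. -/

section Mercer

open scoped InnerProductSpace

variable {ι X Ω : Type*} [MeasurableSpace X] [MeasurableSpace Ω] {ρ : Measure X} {P : Measure Ω}
  {G : X → Ω → ℂ} [SFinite ρ] [SFinite P] [SecondCountableTopology (Lp ℂ 2 ρ)]

theorem ae_hasSum_covKernel [Countable ι] (hG : MemLp (fun p : X × Ω => G p.1 p.2) 2 (ρ.prod P))
    (hm : Measurable fun p : X × Ω => G p.1 p.2) (h2 : ∀ t, MemLp (G t) 2 P)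
    (h0 : ∀ t, ∫ ω, G t ω ∂P = 0) {α : ι → ℝ} {e : ι → Lp ℂ 2 ρ} (hα : ∀ i, 0 < α i)
    (he : Orthonormal ℂ e)
    (heig : ∀ i, covOperator P (randomLp ρ G) (e i) = (α i : ℂ) • e i)
    (hmem : ∀ᵐ ω ∂P, randomLp ρ G ω ∈ (Submodule.span ℂ (Set.range e)).topologicalClosure) :
    ∀ᵐ p ∂(ρ.prod ρ),
      HasSum (fun i => (α i : ℂ) * e i p.1 * conj (e i p.2)) (covKernel P G p.1 p.2) := by
  have hg := memLp_randomLp hG hm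
  have hz := orthonormal_inner_div_sqrt hg hα he heig
  set z : ι → Lp ℂ 2 P := fun i => ((√(α i))⁻¹ : ℂ) •
      (hg.const_inner (𝕜 := ℂ) (e i)).toLp (fun ω => ⟪e i, randomLp ρ G ω⟫_ℂ) with hz_def
  let x : X → Lp ℂ 2 P := fun s => (h2 s).toLp (G s)
  have hs0 : ∀ i, (√(α i) : ℂ) ≠ 0 := fun i =>
    Complex.ofReal_ne_zero.2 (Real.sqrt_pos.2 (hα i)).ne'
  have hss : ∀ i, (√(α i) : ℂ) * √(α i) = α i := fun i => by
    rw [← Complex.ofReal_mul, Real.mul_self_sqrt (hα i).le]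
  have hcoef : ∀ᵐ s ∂ρ, ∀ i, ⟪z i, x s⟫_ℂ = √(α i) * e i s := by
    rw [ae_all_iff]
    intro i
    filter_upwards [coeFn_covOperator_randomLp hG hm (e i), Lp.coeFn_smul (α i : ℂ) (e i)]
      with s h1 h2'
    rw [heig, h2', Pi.smul_apply, smul_eq_mul] at h1
    have h3 : ⟪(hg.const_inner (𝕜 := ℂ) (e i)).toLp (fun ω => ⟪e i, randomLp ρ G ω⟫_ℂ), x s⟫_ℂ =
        α i * e i s := by
      rw [h1, inner_toLp_right]
      refine integral_congr_ae ?_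
      filter_upwards [(hg.const_inner (𝕜 := ℂ) (e i)).coeFn_toLp] with ω hω
      rw [hω, inner_conj_symm]
    rw [hz_def, inner_smul_left, h3, map_inv₀, Complex.conj_ofReal, ← hss]
    field_simp [hs0 i]
  -- Bessel's inequality in `L²(P)` for `G s` and the orthonormal family `z`.
  have hle : ∀ᵐ s ∂ρ, ∑' i, ENNReal.ofReal (α i) * ‖e i s‖ₑ ^ 2 ≤ ∫⁻ ω, ‖G s ω‖ₑ ^ 2 ∂P := by
    filter_upwards [hcoef] with s hs
    rw [← enorm_sq_toLp (h2 s)]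
    refine le_trans (le_of_eq (tsum_congr fun i => ?_)) (hz.tsum_enorm_sq_le (x s))
    rw [hs i, enorm_mul, mul_pow]
    congr 1
    rw [← enorm_pow, sq, hss, ← ofReal_norm, Complex.norm_real, Real.norm_of_nonneg (hα i).le]
  have hmeas : ∀ i, AEMeasurable (fun s => ‖e i s‖ₑ ^ 2) ρ := fun i =>
    (Lp.memLp (e i)).1.enorm.pow_const 2
  have hone : ∀ i, ∫⁻ s, ‖e i s‖ₑ ^ 2 ∂ρ = 1 := fun i => by
    rw [← enorm_sq_toLp (Lp.memLp (e i)), Lp.toLp_coeFn, ← ofReal_norm, he.1 i]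
    simp
  -- Both integrals equal the sum of the eigenvalues: the left because each `e i` has norm one, the
  -- right because it is `E‖g‖²`.
  have htot : ∫⁻ s, ∑' i, ENNReal.ofReal (α i) * ‖e i s‖ₑ ^ 2 ∂ρ =
      ∫⁻ s, ∫⁻ ω, ‖G s ω‖ₑ ^ 2 ∂P ∂ρ := by
    rw [← lintegral_enorm_sq_randomLp hG hm,
      lintegral_enorm_sq_eq_tsum_eigenvalue hg he heig hmem,
      lintegral_tsum fun i => (hmeas i).const_mul _]
    refine tsum_congr fun i => ?_
    rw [lintegral_const_mul'' _ (hmeas i), hone, mul_one]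
  have hfin : ∫⁻ ω, ‖randomLp ρ G ω‖ₑ ^ 2 ∂P ≠ ⊤ := by
    have h := eLpNorm_nnreal_pow_eq_lintegral (f := randomLp ρ G) (μ := P) (p := 2) two_ne_zero
    simp only [NNReal.coe_ofNat, ENNReal.coe_ofNat, ENNReal.rpow_ofNat] at h
    rw [← h]
    exact (ENNReal.pow_lt_top hg.2).ne
  have heq : ∀ᵐ s ∂ρ, ∑' i, ENNReal.ofReal (α i) * ‖e i s‖ₑ ^ 2 = ∫⁻ ω, ‖G s ω‖ₑ ^ 2 ∂P := by
    refine ae_eq_of_ae_le_of_lintegral_le hle ?_ ?_ htot.ge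
    · rw [htot, ← lintegral_enorm_sq_randomLp hG hm]
      exact hfin
    · exact (hm.enorm.pow_const 2).lintegral_prod_right'.aemeasurable
  have hgood : ∀ᵐ s ∂ρ, HasSum (fun i => ‖⟪z i, x s⟫_ℂ‖ ^ 2) (‖x s‖ ^ 2) := by
    filter_upwards [hcoef, heq] with s hs h
    rw [hasSum_norm_sq_iff_tsum_enorm_sq, enorm_sq_toLp (h2 s), ← h]
    refine tsum_congr fun i => ?_
    rw [hs i, enorm_mul, mul_pow]
    congr 1
    rw [← enorm_pow, sq, hss, ← ofReal_norm, Complex.norm_real, Real.norm_of_nonneg (hα i).le]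
  -- Parseval is needed in the first variable only; in the second it suffices to know the
  -- coefficients.
  filter_upwards [Measure.quasiMeasurePreserving_fst.ae hgood,
    Measure.quasiMeasurePreserving_fst.ae hcoef, Measure.quasiMeasurePreserving_snd.ae hcoef]
    with p hp1 hp2 hp3
  have h := hz.hasSum_inner_mul_inner_of_hasSum_norm_sq hp1 (x p.2)
  have hK : ⟪x p.2, x p.1⟫_ℂ = covKernel P G p.1 p.2 := by
    rw [inner_toLp_right, covKernel]
    refine integral_congr_ae ?_
    filter_upwards [(h2 p.2).coeFn_toLp] with ω hω
    rw [hω, h0, h0, sub_zero, sub_zero, mul_comm]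
  rw [hK] at h
  refine Eq.mp (congrArg (fun f => HasSum f (covKernel P G p.1 p.2)) (funext fun i => ?_)) h
  rw [hp2 i, ← inner_conj_symm, hp3 i, map_mul, Complex.conj_ofReal, ← hss]
  ring

end Mercer

/-! ### Independent standard normal coordinates. -/

section GaussianCoordinates

open scoped InnerProductSpace

variable {ι X Ω : Type*} [MeasurableSpace X] [MeasurableSpace Ω] {ρ : Measure X} {P : Measure Ω}
  {G : X → Ω → ℂ} [SFinite ρ] [SecondCountableTopology (Lp ℂ 2 ρ)]

theorem isGaussianProcess_re_inner_randomLp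
    (hG : MemLp (fun p : X × Ω => G p.1 p.2) 2 (ρ.prod P))
    (hm : Measurable fun p : X × Ω => G p.1 p.2) (hgauss : IsGaussianProcess G P)
    (h0 : ∀ t, ∫ ω, G t ω ∂P = 0) (h : ι → Lp ℂ 2 ρ) :
    IsGaussianProcess (fun i ω => (⟪h i, randomLp ρ G ω⟫_ℂ).re) P := by
  classical
  have := hgauss.isProbabilityMeasure
  have hg := memLp_randomLp hG hm
  have hU : ∀ u : Lp ℂ 2 ρ, AEMeasurable (fun ω => (⟪u, randomLp ρ G ω⟫_ℂ).re) P := fun u =>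
    (hg.const_inner (𝕜 := ℂ) u).re.1.aemeasurable
  refine ⟨fun F => ⟨⟨fun L => ?_⟩⟩⟩
  have hF : AEMeasurable (fun ω => F.restrict fun i => (⟪h i, randomLp ρ G ω⟫_ℂ).re) P :=
    aemeasurable_pi_lambda _ fun i => hU (h i)
  -- A real combination of the variables `Re ⟪h i, g⟫` is again of the form `Re ⟪u, g⟫`, so the
  -- one-dimensional statement yields joint Gaussianity.
  let u : Lp ℂ 2 ρ := ∑ i : F, ((L (Pi.single i 1) : ℝ) : ℂ) • h i
  have hL : ∀ ω, L (F.restrict fun i => (⟪h i, randomLp ρ G ω⟫_ℂ).re) =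
      (⟪u, randomLp ρ G ω⟫_ℂ).re := by
    intro ω
    have hv : ∀ v : F → ℝ, L v = ∑ i, v i * L (Pi.single i 1) := fun v => by
      conv_lhs => rw [← Finset.univ_sum_single v]
      rw [map_sum]
      refine Finset.sum_congr rfl fun i _ => ?_
      rw [← smul_eq_mul, ← map_smul, ← Pi.single_smul, smul_eq_mul, mul_one]
    rw [hv, sum_inner, Complex.re_sum]
    refine Finset.sum_congr rfl fun i _ => ?_
    rw [inner_smul_left, Complex.conj_ofReal, Complex.re_ofReal_mul, mul_comm]
    rfl
  have hlaw : HasGaussianLaw (fun ω => (⟪u, randomLp ρ G ω⟫_ℂ).re) P :=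
    ⟨by rw [map_re_inner_randomLp hG hm hgauss h0]; infer_instance⟩
  have hcomp : ⇑L ∘ (fun ω => F.restrict fun i => (⟪h i, randomLp ρ G ω⟫_ℂ).re) =
      fun ω => (⟪u, randomLp ρ G ω⟫_ℂ).re := funext hL
  rw [AEMeasurable.map_map_of_aemeasurable (by fun_prop) hF, integral_map hF (by fun_prop),
    variance_map (by fun_prop) hF, hcomp, hlaw.map_eq_gaussianReal]
  simp only [hL]

theorem exists_iIndepFun_gaussian [InvolutiveNeg X] [MeasurableNeg X] [ρ.IsNegInvariant]
    (hG : MemLp (fun p : X × Ω => G p.1 p.2) 2 (ρ.prod P))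
    (hm : Measurable fun p : X × Ω => G p.1 p.2) (hgauss : IsGaussianProcess G P)
    (h0 : ∀ t, ∫ ω, G t ω ∂P = 0)
    (hJg : ∀ᵐ ω ∂P, reflConj ρ (randomLp ρ G ω) = randomLp ρ G ω) {α : ι → ℝ}
    {f : ι → Lp ℂ 2 ρ} (hα : ∀ i, 0 < α i) (hf : Orthonormal ℂ f)
    (hJ : ∀ i, reflConj ρ (f i) = f i)
    (heig : ∀ i, covOperator P (randomLp ρ G) (f i) = (α i : ℂ) • f i)
    (hmem : ∀ᵐ ω ∂P, randomLp ρ G ω ∈ (Submodule.span ℂ (Set.range f)).topologicalClosure) :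
    ∃ Z : ι → Ω → ℝ, (∀ i, Measurable (Z i)) ∧ (∀ i, P.map (Z i) = gaussianReal 0 1) ∧
      iIndepFun Z P ∧ ∀ᵐ ω ∂P, MemLp (fun t => G t ω) 2 ρ ∧
        HasSum (fun i => α i * Z i ω ^ 2) (∫ t, ‖G t ω‖ ^ 2 ∂ρ) := by
  classical
  have := hgauss.isProbabilityMeasure
  have hg := memLp_randomLp hG hm
  let h : ι → Lp ℂ 2 ρ := fun i => ((√(α i))⁻¹ : ℂ) • f i
  -- Written as an integral of `G` because `Z i` has to be measurable everywhere, while `randomLp`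
  -- is known to be measurable only up to a null set.
  let Z : ι → Ω → ℝ := fun i ω => (∫ s, conj (h i s) * G s ω ∂ρ).re
  have hsq : ∀ i, √(α i) * √(α i) = α i := fun i => Real.mul_self_sqrt (hα i).le
  have hs0 : ∀ i, √(α i) ≠ 0 := fun i => (Real.sqrt_pos.2 (hα i)).ne'
  have hZm : ∀ i, Measurable (Z i) := by
    intro i
    have h1 : Measurable fun p : X × Ω => conj (h i p.1) * G p.1 p.2 :=
      (Complex.continuous_conj.measurable.comp
        ((Lp.stronglyMeasurable (h i)).measurable.comp measurable_fst)).mul hm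
    exact Complex.measurable_re.comp h1.stronglyMeasurable.integral_prod_left'.measurable
  have hZ : ∀ᵐ ω ∂P, ∀ i, Z i ω = (⟪h i, randomLp ρ G ω⟫_ℂ).re := by
    filter_upwards [hG.ae_memLp_section hm] with ω hω i
    rw [inner_randomLp _ hω]
  have hZ' : ∀ i, (fun ω => (⟪h i, randomLp ρ G ω⟫_ℂ).re) =ᵐ[P] Z i := fun i => by
    filter_upwards [hZ] with ω hω
    exact (hω i).symm
  -- Both `f i` and the path are fixed by the antiunitary `reflConj`, so their inner product is its
  -- own conjugate and `Z i` carries the whole coordinate.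
  have hreal : ∀ᵐ ω ∂P, ∀ i, ⟪f i, randomLp ρ G ω⟫_ℂ = ((√(α i) * Z i ω : ℝ) : ℂ) := by
    filter_upwards [hJg, hZ] with ω hω hω' i
    have h1 : conj ⟪f i, randomLp ρ G ω⟫_ℂ = ⟪f i, randomLp ρ G ω⟫_ℂ := by
      rw [← inner_reflConj, hJ, hω]
    rw [hω', inner_smul_left, map_inv₀, Complex.conj_ofReal, ← Complex.ofReal_inv,
      Complex.re_ofReal_mul, mul_inv_cancel_left₀ (hs0 i)]
    exact (Complex.conj_eq_iff_re.1 h1).symm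
  have hZproc : IsGaussianProcess Z P :=
    (isGaussianProcess_re_inner_randomLp hG hm hgauss h0 h).congr hZ'
  have hprod : ∀ i j, ∫ ω, Z i ω * Z j ω ∂P = if i = j then 1 else 0 := by
    intro i j
    have h1 := inner_covOperator hg (f i) (f j)
    rw [heig, inner_smul_right, orthonormal_iff_ite.1 hf] at h1
    have h2 : ∫ ω, ⟪f i, randomLp ρ G ω⟫_ℂ * ⟪randomLp ρ G ω, f j⟫_ℂ ∂P =
        ((√(α i) * √(α j) * ∫ ω, Z i ω * Z j ω ∂P : ℝ) : ℂ) := by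
      rw [← integral_const_mul, ← integral_complex_ofReal]
      refine integral_congr_ae ?_
      filter_upwards [hreal] with ω hω
      rw [← inner_conj_symm _ (f j), hω, hω, Complex.conj_ofReal]
      push_cast
      ring
    rw [h2] at h1
    have h3 : α j * (if i = j then 1 else 0) = √(α i) * √(α j) * ∫ ω, Z i ω * Z j ω ∂P := by
      apply Complex.ofReal_injective
      rw [← h1]
      split_ifs <;> simp
    split_ifs at h3 ⊢ with hij
    · subst hij
      rw [hsq, mul_one] at h3
      exact mul_left_cancel₀ (hα i).ne' (by rw [← h3, mul_one])
    · rw [mul_zero] at h3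
      exact (mul_eq_zero.1 h3.symm).resolve_left (mul_ne_zero (hs0 i) (hs0 j))
  have hlaw : ∀ i, P.map (Z i) = gaussianReal 0 1 := by
    intro i
    rw [← Measure.map_congr (hZ' i), map_re_inner_randomLp hG hm hgauss h0]
    have h1 : ∫ ω, (⟪h i, randomLp ρ G ω⟫_ℂ).re ^ 2 ∂P = 1 := by
      have := hprod i i
      rw [if_pos rfl] at this
      rw [← this]
      refine integral_congr_ae ?_
      filter_upwards [hZ' i] with ω hω
      rw [hω, sq]
    rw [h1, Real.toNNReal_one]
  have hmean : ∀ i, ∫ ω, Z i ω ∂P = 0 := by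
    intro i
    rw [← integral_map (f := fun x => x) (hZm i).aemeasurable (by fun_prop), hlaw,
      integral_id_gaussianReal]
  refine ⟨Z, hZm, hlaw, ?_, ?_⟩
  · rw [iIndepFun_iff_finset]
    intro F
    refine (hZproc.hasGaussianLaw F).iIndepFun_of_covariance_eq_zero fun i j hij => ?_
    have hmZ : ∀ k, MemLp (Z k) 2 P := fun k => (hZproc.hasGaussianLaw_eval k).memLp_two
    have hij' : (i : ι) ≠ j := fun h => hij (Subtype.ext h)
    change cov[Z i, Z j; P] = 0
    rw [covariance_eq_sub (hmZ i) (hmZ j)]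
    simp only [Pi.mul_apply]
    rw [hprod, if_neg hij', hmean, hmean]
    simp
  · filter_upwards [hG.ae_memLp_section hm, hreal, hmem] with ω h1 h2 h3
    refine ⟨h1, ?_⟩
    have h4 := hf.hasSum_norm_sq_of_mem_closure h3
    rw [norm_sq_randomLp h1] at h4
    refine Eq.mp (congrArg (fun f => HasSum f (∫ t, ‖G t ω‖ ^ 2 ∂ρ)) (funext fun i => ?_)) h4
    rw [h2, Complex.norm_real, Real.norm_eq_abs, sq_abs, mul_pow, Real.sq_sqrt (hα i).le]

end GaussianCoordinates

/-! ### Square integrability of the field and the main theorem. -/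

theorem memLp_uncurry_of_integrable_covKernel {X Ω : Type*} [MeasurableSpace X]
    [MeasurableSpace Ω] {ρ : Measure X} {P : Measure Ω} [SFinite P]
    {G : X → Ω → ℂ} (hm : Measurable fun p : X × Ω => G p.1 p.2) (h2 : ∀ t, MemLp (G t) 2 P)
    (h0 : ∀ t, ∫ ω, G t ω ∂P = 0) (hint : Integrable (fun t => covKernel P G t t) ρ) :
    MemLp (fun p : X × Ω => G p.1 p.2) 2 (ρ.prod P) := by
  rw [memLp_two_iff_integrable_sq_norm hm.aestronglyMeasurable,
    integrable_prod_iff (hm.norm.pow_const 2).aestronglyMeasurable]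
  refine ⟨Filter.Eventually.of_forall fun t => (h2 t).integrable_norm_pow (by norm_num), ?_⟩
  refine hint.norm.congr (Filter.Eventually.of_forall fun t => ?_)
  have h : covKernel P G t t = ((∫ ω, ‖‖G t ω‖ ^ 2‖ ∂P : ℝ) : ℂ) := by
    rw [covKernel, ← integral_complex_ofReal]
    refine integral_congr_ae (Filter.Eventually.of_forall fun ω => ?_)
    simp only [h0, sub_zero]
    rw [Complex.mul_conj, Complex.normSq_eq_norm_sq, Real.norm_of_nonneg (by positivity)]
  simp only
  rw [h, Complex.norm_real, Real.norm_of_nonneg (integral_nonneg fun ω => norm_nonneg _)]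

theorem theorem3p3 {d : ℕ} {Ω : Type*} [MeasurableSpace Ω] (P : Measure Ω) [IsProbabilityMeasure P]
    (G : EuclideanSpace ℝ (Fin d) → Ω → ℂ) (hG : IsHermitianGaussianField P G)
    (ρ : Measure (EuclideanSpace ℝ (Fin d))) [SigmaFinite ρ] [ρ.IsNegInvariant]
    (hint : Integrable (fun t => covKernel P G t t) ρ) :
    -- a system as in Mercer's theorem exists,
    (∃ (I : Set ℕ) (α : I → ℝ) (e : I → Lp ℂ 2 ρ), IsMercerSystem ρ (covKernel P G) I α e) ∧
    -- and every such system satisfies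
    ∀ (I : Set ℕ) (α : I → ℝ) (e : I → Lp ℂ 2 ρ), IsMercerSystem ρ (covKernel P G) I α e →
      -- Mercer's representation of the kernel and
      (∀ᵐ p ∂(ρ.prod ρ),
        HasSum (fun i => (α i : ℂ) * e i p.1 * conj (e i p.2)) (covKernel P G p.1 p.2)) ∧
      -- the representation of the squared norm of `G` as a Gaussian quadratic form.
      ∃ Z : I → Ω → ℝ,
        (∀ i, Measurable (Z i)) ∧ (∀ i, P.map (Z i) = gaussianReal 0 1) ∧ iIndepFun Z P ∧
        ∀ᵐ ω ∂P, MemLp (fun t => G t ω) 2 ρ ∧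
          HasSum (fun i => α i * Z i ω ^ 2) (∫ t, ‖G t ω‖ ^ 2 ∂ρ) := by
  -- Needed for the instance that makes `L²(ρ)` second countable.
  have : Fact ((2 : ENNReal) ≠ ⊤) := ⟨ENNReal.ofNat_ne_top⟩
  have h2 := hG.memLp_two
  have h0 := hG.centered
  have hm := hG.measurable
  have hGL := memLp_uncurry_of_integrable_covKernel hm h2 h0 hint
  have hg := memLp_randomLp hGL hm
  have hop : kernelOperator ρ (covKernel P G) = covOperator P (randomLp ρ G) :=
    funext fun v => kernelOperator_covKernel hGL hm h2 h0 v
  have hsymm := isSymmetric_covOperator hg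
  have hcomp := isCompactOperator_covOperator hg
  have hherm : ∀ s t, ∫ ω, G s ω * conj (G t ω) ∂P = ∫ ω, G s ω * G (-t) ω ∂P := by
    intro s t
    have h := hG.hermitian s t
    simpa only [covKernel, pseudoCovKernel, h0, sub_zero] using h
  have hJg : ∀ᵐ ω ∂P, reflConj ρ (randomLp ρ G ω) = randomLp ρ G ω :=
    ae_reflConj_randomLp hGL hm fun t => ae_neg_eq_conj h2 hherm t
  obtain ⟨n, b, hb, hbJ, hbeig, hbspan⟩ := hsymm.exists_fixed_eigenbasis hcomp (reflConj ρ)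
    reflConj_reflConj inner_reflConj
    (covOperator_comm_conjugation hg _ reflConj_reflConj inner_reflConj hJg)
  have hbrange : Set.range (covOperator P (randomLp ρ G)) ⊆
      closure (Submodule.span ℂ (Set.range b) : Set (Lp ℂ 2 ρ)) := by
    refine hsymm.range_subset_closure_span hcomp (re_inner_covOperator_nonneg hg) b fun l hl => ?_
    rw [← hbspan ⟨l, hl⟩]
    refine Submodule.span_mono ?_
    rintro _ ⟨k, rfl⟩
    exact ⟨_, rfl⟩
  have hmem : ∀ {ι : Type} (e : ι → Lp ℂ 2 ρ), Set.range (covOperator P (randomLp ρ G)) ⊆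
      closure (Submodule.span ℂ (Set.range e) : Set (Lp ℂ 2 ρ)) →
      ∀ᵐ ω ∂P, randomLp ρ G ω ∈ (Submodule.span ℂ (Set.range e)).topologicalClosure :=
    fun e he => ae_mem_of_range_covOperator_subset hg
      (Submodule.isClosed_topologicalClosure _) fun v => he ⟨v, rfl⟩
  refine ⟨?_, fun I α e hsys => ?_⟩
  · obtain ⟨I, φ, hφ⟩ := exists_antitone_enumeration
      (fun s : (Σ l : {l : ℝ // 0 < l}, Fin (n l)) => (s.1 : ℝ)) (fun s => s.1.2)
      fun c hc => finite_setOf_le_eigenvalue (sum_inner_covOperator_le hg) hb hbeig hc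
    refine ⟨I, fun i => (φ i).1, fun i => b (φ i), fun i => (φ i).1.2, hφ,
      hb.comp _ φ.injective, fun i => ?_, ?_⟩
    · rw [hop, hbeig]
    · have hr : Set.range (fun i => b (φ i)) = Set.range b := φ.surjective.range_comp b
      rw [hop, hr]
      exact closure_range_eq_closure_span (fun s => s.1.2.ne') hbeig hbrange
  · have heig : ∀ i, covOperator P (randomLp ρ G) (e i) = (α i : ℂ) • e i := fun i => by
      rw [← hop, hsys.eigen]
    have herange : Set.range (covOperator P (randomLp ρ G)) ⊆
        closure (Submodule.span ℂ (Set.range e) : Set (Lp ℂ 2 ρ)) := by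
      rw [← hsys.closure_range, hop]
      exact subset_closure
    refine ⟨ae_hasSum_covKernel hGL hm h2 h0 hsys.pos hsys.orthonormal heig (hmem e herange), ?_⟩
    -- The given `e i` need not be fixed by `reflConj`, so the `Z i` are built from the vectors `b
    -- (φ i)`, which have the same eigenvalues `α i`.
    obtain ⟨φ, hφ⟩ := hsymm.exists_equiv_eigenbasis hcomp hb hbspan hsys.pos hsys.orthonormal
      heig herange
    have hr : Set.range (fun i => b (φ i)) = Set.range b := φ.surjective.range_comp b
    refine exists_iIndepFun_gaussian hGL hm hG.gaussian h0 hJg hsys.pos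
      (hb.comp _ φ.injective) (fun i => hbJ _) (fun i => ?_) (hmem _ ?_)
    · rw [Function.comp_apply, hbeig, hφ]
    · change Set.range _ ⊆ closure (Submodule.span ℂ (Set.range fun i => b (φ i)) : Set (Lp ℂ 2 ρ))
      rw [hr]
      exact hbrange
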